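/- Let $N\ge 1$, let $a_0,\dots,a_{N-1}\ge 0$ be real numbers, $S=\sum_{k} a_k$, and consider on $N\times N$ complex matrices the diagonal Lindbladian $$\mathcal L(\rho)=\sum_{k,l=0}^{N-1}a_{k}\big(2\langle l|\rho|l\rangle\,|k\rangle\langle k|-|l\rangle\langle l|\rho-\rho|l\rangle\langle l|\big),$$ i.e. the generator with zero Hamiltonian whose overcomplete GKS matrix $A$ is diagonal with entries $A_{(k,l),(k,l)}=a_k$ independent of $l$ (so $A$ has full rank $N^2$ when all $a_k>0$). There is a polynomial $p$ such that for every $N\ge1$ there is a quantum circuit, depending only on $N$, with at most $p(\lceil\log_2 N\rceil)$ elementary instructions, that for all $a_k\ge 0$ as above and all $t>0$, given a black box that computes $\sum_{k=k_1}^{k_2}a_k$ for $0\le k_1\le k_2\le N-1$ and given $t$, implements the quantum operation $e^{\mathcal L t}$ exactly: if the input $\rho$ is encoded in binary in $\lceil\log_2N\rceil$ qubits, and all ancillas are traced out at the end, the output is the encoding of $e^{\mathcal Lt}(\rho)$, without error. Here numbers are treated exactly: besides qubits, the circuit has registers holding real numbers, into which the black box writes its answers, and the instructions, each of cost one, are arbitrary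 2-qubit gates, queries, adding a qubit's value to a real register, adding to a real register the constant $1$ or a copy, product, quotient, square root, exponential or arccosine of the contents of other registers, and rotating a qubit by the angle held in a real register (each of these and its adjoint). A query with indices outside the range $0\le k_1\le k_2\le N-1$ does nothing. Moreover, with $\tau=\frac1S\sum_k a_k|k\rangle\langle k|$ (read as $\tau=0$ if $S=0$), one has $\mathcal L(\tau)=0$, $\operatorname{Tr}\tau=1$ if $S>0$, and for all $t>0$ $$e^{\mathcal Lt}(|u\rangle\langle u|)=e^{-2St}|u\rangle\langle u|+(1-e^{-2St})\,\tau,\qquad e^{\mathcal Lt}(|u\rangle\langle v|)=e^{-2St}|u\rangle\langle v|\quad(u\ne v),$$ and the map $V:\mathbb C^N\to\mathbb C^N\otimes\mathbb C^N\otimes\mathbb C^{N+1}$, $$V|m\rangle=e^{-St}|m\rangle|0\rangle|0\rangle+\sum_{k=0}^{N-1}\sqrt{\tfrac{(1-e^{-2St})a_k}{S}}\;|k\rangle|k\rangle|m+1\rangle$$ (the sum being $0$ if $S=0$), is an isometry with $e^{\mathcal Lt}(\rho)=\operatorname{Tr}_{\mathrm{anc}}[V\rho V^\dagger]$ for all $\rho$,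 where the trace is over the last two factors. -/

import Mathlib

open Matrix

noncomputable section

namespace DenseDiagonal

/-! ### Lindbladians in overcomplete GKS form -/

/-- The generator (with vanishing Hamiltonian) given by an overcomplete GKS matrix `A`:
`∑ A_{(k,l),(k',l')} (2 ⟨l|ρ|l'⟩ |k⟩⟨k'| - δ_{kk'} |l'⟩⟨l| ρ - δ_{kk'} ρ |l'⟩⟨l|)`. -/
def gksGenerator {N : ℕ} (A : Matrix (Fin N × Fin N) (Fin N × Fin N) ℂ)
    (ρ : Matrix (Fin N) (Fin N) ℂ) : Matrix (Fin N) (Fin N) ℂ :=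
  ∑ k, ∑ l, ∑ k', ∑ l', A (k, l) (k', l') •
    ((2 * ρ l l') • Matrix.single k k' (1 : ℂ)
      - (if k = k' then (1 : ℂ) else 0) • (Matrix.single l' l (1 : ℂ) * ρ)
      - (if k = k' then (1 : ℂ) else 0) • (ρ * Matrix.single l' l (1 : ℂ)))

/-- The diagonal Lindbladian with coefficients `a k l`:
`∑ a_{k,l} (2 ⟨l|ρ|l⟩ |k⟩⟨k| - |l⟩⟨l| ρ - ρ |l⟩⟨l|)`. -/
def diagonalLindbladian {N : ℕ} (a : Fin N → Fin N → ℝ)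
    (ρ : Matrix (Fin N) (Fin N) ℂ) : Matrix (Fin N) (Fin N) ℂ :=
  ∑ k, ∑ l, (a k l : ℂ) •
    ((2 * ρ l l) • Matrix.single k k (1 : ℂ)
      - Matrix.single l l (1 : ℂ) * ρ - ρ * Matrix.single l l (1 : ℂ))

/-- `E = e^{L t}`: the exponential series `∑ (t^j / j!) L^j` converges pointwise to `E`. -/
def IsExp {N : ℕ} (L : Matrix (Fin N) (Fin N) ℂ → Matrix (Fin N) (Fin N) ℂ) (t : ℝ)
    (E : Matrix (Fin N) (Fin N) ℂ → Matrix (Fin N) (Fin N) ℂ) : Prop :=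
  ∀ ρ, HasSum (fun j : ℕ => ((t ^ j / (j.factorial : ℝ) : ℝ) : ℂ) • (L^[j]) ρ) (E ρ)

/-- The diagonal state `∑ a_k |k⟩⟨k| / S` with `S = ∑ a_k`. -/
def fixedState {N : ℕ} (a : Fin N → ℝ) : Matrix (Fin N) (Fin N) ℂ :=
  Matrix.diagonal fun k => ((a k / ∑ i, a i : ℝ) : ℂ)

/-- The map `V : ℂ^N → ℂ^N ⊗ ℂ^N ⊗ ℂ^(N+1)`,
`V|m⟩ = e^{-St} |m⟩|0⟩|0⟩ + ∑ k, √((1 - e^{-2St}) a_k / S) |k⟩|k⟩|m+1⟩`, `S = ∑ a_k`.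
The last two tensor factors are the ancilla. -/
def stinespring {N : ℕ} (a : Fin N → ℝ) (t : ℝ) :
    Matrix (Fin N × (Fin N × Fin (N + 1))) (Fin N) ℂ :=
  fun b m =>
    (if b.1 = m ∧ (b.2.1 : ℕ) = 0 ∧ (b.2.2 : ℕ) = 0 then
      ((Real.exp (-(∑ i, a i) * t) : ℝ) : ℂ) else 0)
    + (if b.2.1 = b.1 ∧ (b.2.2 : ℕ) = m + 1 then
      ((Real.sqrt ((1 - Real.exp (-2 * (∑ i, a i) * t)) * a b.1 / ∑ i, a i) : ℝ) : ℂ) else 0)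

/-- Partial trace over the second tensor factor. -/
def traceAnc {ι κ : Type*} [Fintype κ] (X : Matrix (ι × κ) (ι × κ) ℂ) : Matrix ι ι ℂ :=
  fun x y => ∑ e, X (x, e) (y, e)

/-! ### Quantum circuits with a black box that returns real numbers

A circuit acts on `n` system qubits, `s` ancilla qubits, and `r + 1` ancilla registers that hold
real numbers (the answers of the black box, and numbers computed from them, exactly).
A computational basis state is a bit for every qubit together with the contents of the registers;
a pure state is a finite superposition of basis states. -/

/-- Contents of all qubits: `Sum.inl` are the system qubits, `Sum.inr` the ancilla qubits. -/
abbrev Bits (n s : ℕ) := Fin n ⊕ Fin s → Bool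

/-- Contents of the real registers. -/
abbrev Regs (r : ℕ) := Fin (r + 1) → ℝ

/-- Labels of the computational basis states. -/
abbrev Config (n s r : ℕ) := Bits n s × Regs r

/-- Pure states. -/
abbrev State (n s r : ℕ) := Config n s r →₀ ℂ

/-- Elementary operations on real numbers (unary ones ignore the second argument). -/
inductive RealOp
  | one
  | copy
  | mul
  | div
  | sqrt
  | exp
  | arccos

/-- The function computed by an elementary operation. -/
def RealOp.eval : RealOp → ℝ → ℝ → ℝ
  | .one, _, _ => 1
  | .copy, x, _ => x
  | .mul, x, y => x * y
  | .div, x, y => x / y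
  | .sqrt, x, _ => Real.sqrt x
  | .exp, x, _ => Real.exp x
  | .arccos, x, _ => Real.arccos x

/-- Elementary instructions. The flag `adj` selects the adjoint of the instruction.
* `gate i j _ U` applies the 2-qubit gate `U` to the qubits `i`, `j`.
* `query k₁ k₂ _ d _` reads two indices in binary from two disjoint registers of `n` qubits and adds
  the answer of the black box to the real register `d`.
* `load i d _` adds the bit in qubit `i` to the real register `d`.
* `arith op x y d _ _ _` adds `op (z x) (z y)` to the real register `d`, which is
  different from `x` and `y`.
* `rot i x _` rotates the qubit `i` by the angle in the real register `x`. -/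
inductive Instr (n s r : ℕ)
  | gate (i j : Fin n ⊕ Fin s) (hij : i ≠ j) (U : Matrix.unitaryGroup (Bool × Bool) ℂ)
  | query (k₁ k₂ : Fin n → Fin n ⊕ Fin s) (hk : Function.Injective (Sum.elim k₁ k₂))
      (d : Fin (r + 1)) (adj : Bool)
  | load (i : Fin n ⊕ Fin s) (d : Fin (r + 1)) (adj : Bool)
  | arith (op : RealOp) (x y d : Fin (r + 1)) (hx : x ≠ d) (hy : y ≠ d) (adj : Bool)
  | rot (i : Fin n ⊕ Fin s) (x : Fin (r + 1)) (adj : Bool)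

/-- A circuit is a list of instructions, executed from left to right. -/
abbrev Circuit (n s r : ℕ) := List (Instr n s r)

/-- The sign selected by the flag `adj`. -/
def sgn (adj : Bool) : ℝ := if adj then -1 else 1

/-- The black box for the coefficients `a`: on `k₁ ≤ k₂` in `{0, …, N-1}` it answers
`∑_{k=k₁}^{k₂} a_k`. On any other input it answers `0`, so that a query does nothing. -/
def blackBox {N : ℕ} (a : Fin N → ℝ) (k₁ k₂ : ℕ) : ℝ :=
  if k₁ ≤ k₂ ∧ k₂ < N then ∑ k : Fin N, if k₁ ≤ (k : ℕ) ∧ (k : ℕ) ≤ k₂ then a k else 0 else 0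

/-- The rotation `[[cos θ, -sin θ], [sin θ, cos θ]]`, with `false` for `|0⟩`, `true` for `|1⟩`. -/
def rotMatrix (θ : ℝ) : Matrix Bool Bool ℂ := fun y x =>
  match y, x with
  | false, false => (Real.cos θ : ℂ)
  | false, true => -(Real.sin θ : ℂ)
  | true, false => (Real.sin θ : ℂ)
  | true, true => (Real.cos θ : ℂ)

/-- The image of a basis state under an instruction, for the black box `f`. -/
def Instr.onBasis {n s r : ℕ} (f : ℕ → ℕ → ℝ) : Instr n s r → Config n s r → State n s r
  | .gate i j _ U, (x, z) =>
      ∑ y : Bool × Bool, Finsupp.single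
        (Function.update (Function.update x i y.1) j y.2, z) ((U : Matrix _ _ ℂ) y (x i, x j))
  | .query k₁ k₂ _ d adj, (x, z) =>
      Finsupp.single (x, Function.update z d (z d + sgn adj *
        f (Nat.ofBits fun i => x (k₁ i)) (Nat.ofBits fun i => x (k₂ i)))) 1
  | .load i d adj, (x, z) =>
      Finsupp.single (x, Function.update z d (z d + sgn adj * (if x i then 1 else 0))) 1
  | .arith op u v d _ _ adj, (x, z) =>
      Finsupp.single (x, Function.update z d (z d + sgn adj * op.eval (z u) (z v))) 1
  | .rot i u adj, (x, z) =>
      ∑ y : Bool, Finsupp.single (Function.update x i y, z) (rotMatrix (sgn adj * z u) y (x i))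

/-- The linear action of an instruction. -/
def Instr.apply {n s r : ℕ} (f : ℕ → ℕ → ℝ) (g : Instr n s r) (ψ : State n s r) : State n s r :=
  ψ.sum fun c w => w • g.onBasis f c

/-- The linear action of a circuit. -/
def Circuit.apply {n s r : ℕ} (f : ℕ → ℕ → ℝ) (C : Circuit n s r) (ψ : State n s r) :
    State n s r :=
  C.foldl (fun φ g => g.apply f φ) ψ

/-- The binary encoding of an index, least significant bit first. -/
def encode {N : ℕ} (n : ℕ) (m : Fin N) : Fin n → Bool := fun i => (m : ℕ).testBit i

/-- The isometry from `ℂ^N` to `n` qubits given by the binary encoding (for `N ≤ 2 ^ n`). -/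
def encodeMatrix (N n : ℕ) : Matrix (Fin n → Bool) (Fin N) ℂ :=
  fun x m => if x = encode n m then 1 else 0

/-- The initial state: `|m⟩` in the system, all ancilla qubits `|0⟩`, the time `t` in the real
register `0`, and `0` in every other real register. -/
def initState {N : ℕ} (n s r : ℕ) (t : ℝ) (m : Fin N) : State n s r :=
  Finsupp.single (Sum.elim (encode n m) (fun _ => false), fun i => if i = 0 then t else 0) 1

/-- The partial trace of `|ψ⟩⟨φ|` over the ancilla qubits and the real registers.
The sum has only finitely many nonzero terms. -/
def reduced {n s r : ℕ} (ψ φ : State n s r) : Matrix (Fin n → Bool) (Fin n → Bool) ℂ :=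
  fun x y => ∑ᶠ e : (Fin s → Bool) × Regs r,
    ψ (Sum.elim x e.1, e.2) * star (φ (Sum.elim y e.1, e.2))

/-- The quantum operation of a circuit with black box `f` and time parameter `t`: encode `ρ`, run
the circuit, trace out the ancilla. -/
def Circuit.channel {N n s r : ℕ} (C : Circuit n s r) (f : ℕ → ℕ → ℝ) (t : ℝ)
    (ρ : Matrix (Fin N) (Fin N) ℂ) : Matrix (Fin n → Bool) (Fin n → Bool) ℂ :=
  ∑ m, ∑ m', ρ m m' •
    reduced (C.apply f (initState n s r t m)) (C.apply f (initState n s r t m'))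

end DenseDiagonal

end

/-!
The generator is `ρ ↦ 2 S (tr ρ • τ - ρ)`, with `S` the sum of the rates and `τ` the fixed state,
so that all its powers are explicit and its semigroup is
`relaxation a t ρ = e^{-2St} ρ + (1 - e^{-2St}) tr ρ • τ`: with probability `1 - e^{-2St}` the state
is discarded and replaced by `τ`. For `S = 0` the junk value `τ = 0` is harmless, because then both
the generator and the factor `1 - e^{-2St}` vanish.

The circuit `mainCircuit` follows this description. It rotates a flag qubit by the angle with cosine
`e^{-St}`, prepares in `n` ancilla qubits an index `k` with amplitude `√(a k / S)`, and moves the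
index into the system if the flag is set.

* The index is prepared digit by digit, from the top (`apply_prepCircuit`): an interval of indices
  is split into its halves by a rotation whose squared cosine is the relative weight of the lower
  half. Weights are differences of the tail sums `∑_{k ≥ κ} a k`, each of which is one query with
  the constant upper end `N - 1`. The quotients, roots and angles computed on the way stay in fresh
  registers. They depend on the index only, not on the system and the flag, and therefore they
  never have to be erased.
* In the transfer (`apply_transferCircuit_false`, `apply_transferCircuit_true`) every system bit
  is rotated by `f * (y - x) * π / 2`, with `x` the bit, `y` the digit of the index and `f` the
  flag. The product is kept. If the flag is not set it is `0`, so the ancilla is independent of the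
  system and all coherences survive. If the flag is set, it records the former contents of the
  system, and together with the index qubits it destroys all coherences.

`apply_mainCircuit` records the resulting final state, `reduced_final` its partial trace, and
`channel_mainCircuit` compares it with the semigroup.
-/

namespace DenseDiagonal

/-! ### The semigroup and its dilation -/

section Semigroup

variable {N : ℕ}

theorem diagonalLindbladian_eq_gksGenerator (a : Fin N → ℝ) :
    diagonalLindbladian (fun k _ => a k) =
      gksGenerator (Matrix.diagonal fun kl : Fin N × Fin N => (a kl.1 : ℂ)) := by
  funext ρ
  unfold diagonalLindbladian gksGenerator
  refine Finset.sum_congr rfl fun k _ => Finset.sum_congr rfl fun l _ => ?_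
  rw [Finset.sum_eq_single k, Finset.sum_eq_single l]
  · simp
  · intro l' _ h
    simp [h.symm]
  · simp
  · intro k' _ h
    refine Finset.sum_eq_zero fun l' _ => ?_
    simp [h.symm]
  · simp

theorem rank_diagonal_of_pos (a : Fin N → ℝ) (ha : ∀ k, 0 < a k) :
    (Matrix.diagonal fun kl : Fin N × Fin N => (a kl.1 : ℂ)).rank = N ^ 2 := by
  rw [Matrix.rank_diagonal, Fintype.card_subtype]
  have h : ∀ kl : Fin N × Fin N, (a kl.1 : ℂ) ≠ 0 := fun kl =>
    Complex.ofReal_ne_zero.2 (ha kl.1).ne'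
  simp [h, sq]

theorem diagonalLindbladian_eq (a : Fin N → ℝ) (ρ : Matrix (Fin N) (Fin N) ℂ) :
    diagonalLindbladian (fun k _ => a k) ρ =
      (2 * ρ.trace) • Matrix.diagonal (fun k => (a k : ℂ))
        - (2 * ((∑ k, a k : ℝ) : ℂ)) • ρ := by
  have h1 : ∑ l, Matrix.single l l (1 : ℂ) * ρ = ρ := by
    rw [← Finset.sum_mul]
    rw [Matrix.sum_single_one, one_mul]
  have h2 : ∑ l, ρ * Matrix.single l l (1 : ℂ) = ρ := by
    rw [← Finset.mul_sum, Matrix.sum_single_one, mul_one]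
  have h3 : ∑ k, (a k : ℂ) • Matrix.single k k (1 : ℂ) =
      Matrix.diagonal (fun k => (a k : ℂ)) := by
    ext i j
    simp [Matrix.sum_apply, Matrix.single_apply, Matrix.diagonal_apply, ite_and]
  unfold diagonalLindbladian
  have h4 : ∀ k : Fin N, ∑ l, (a k : ℂ) • ((2 * ρ l l) • Matrix.single k k (1 : ℂ)
      - Matrix.single l l (1 : ℂ) * ρ - ρ * Matrix.single l l (1 : ℂ)) =
      (2 * ρ.trace) • ((a k : ℂ) • Matrix.single k k (1 : ℂ)) - (2 * (a k : ℂ)) • ρ := by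
    intro k
    rw [← Finset.smul_sum, Finset.sum_sub_distrib, Finset.sum_sub_distrib, h1, h2,
      ← Finset.sum_smul, ← Finset.mul_sum]
    change (a k : ℂ) • ((2 * ρ.trace) • _ - ρ - ρ) = _
    module
  rw [Finset.sum_congr rfl fun k _ => h4 k, Finset.sum_sub_distrib, ← Finset.smul_sum, h3,
    ← Finset.sum_smul, ← Finset.mul_sum]
  push_cast
  rfl

theorem eq_zero_of_sum_eq_zero {a : Fin N → ℝ} (ha : ∀ k, 0 ≤ a k) (hS : ∑ k, a k = 0)
    (k : Fin N) : a k = 0 :=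
  (Finset.sum_eq_zero_iff_of_nonneg fun i _ => ha i).1 hS k (Finset.mem_univ k)

theorem sum_smul_fixedState {a : Fin N → ℝ} (ha : ∀ k, 0 ≤ a k) :
    ((∑ k, a k : ℝ) : ℂ) • fixedState a = Matrix.diagonal (fun k => (a k : ℂ)) := by
  unfold fixedState
  rw [← Matrix.diagonal_smul]
  congr 1
  funext k
  rw [Pi.smul_apply, smul_eq_mul, ← Complex.ofReal_mul]
  by_cases hS : ∑ k, a k = 0
  · rw [hS, eq_zero_of_sum_eq_zero ha hS k]
    simp
  · rw [mul_div_cancel₀ _ hS]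

theorem trace_fixedState (a : Fin N → ℝ) :
    (fixedState a).trace = (((∑ k, a k) / ∑ k, a k : ℝ) : ℂ) := by
  unfold fixedState
  rw [Matrix.trace_diagonal, ← Complex.ofReal_sum, Finset.sum_div]

/-- The generator relaxes every state towards the fixed state at the rate `2S`. -/
theorem diagonalLindbladian_eq_smul {a : Fin N → ℝ} (ha : ∀ k, 0 ≤ a k)
    (ρ : Matrix (Fin N) (Fin N) ℂ) :
    diagonalLindbladian (fun k _ => a k) ρ =
      (2 * ((∑ k, a k : ℝ) : ℂ)) • (ρ.trace • fixedState a - ρ) := by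
  rw [diagonalLindbladian_eq, ← sum_smul_fixedState ha]
  module

theorem sum_mul_trace_fixedState (a : Fin N → ℝ) :
    ((∑ k, a k : ℝ) : ℂ) * (fixedState a).trace = ((∑ k, a k : ℝ) : ℂ) := by
  rw [trace_fixedState, ← Complex.ofReal_mul]
  by_cases hS : ∑ k, a k = 0
  · simp [hS]
  · rw [mul_div_cancel₀ _ hS]

theorem diagonalLindbladian_fixedState {a : Fin N → ℝ} (ha : ∀ k, 0 ≤ a k) :
    diagonalLindbladian (fun k _ => a k) (fixedState a) = 0 := by
  rw [diagonalLindbladian_eq_smul ha, smul_sub, smul_smul, mul_assoc,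
    sum_mul_trace_fixedState, sub_self]

/-- The semigroup in closed form: a mixture of the identity and of the map that replaces the
input by the fixed state. -/
noncomputable def relaxation (a : Fin N → ℝ) (t : ℝ) (ρ : Matrix (Fin N) (Fin N) ℂ) :
    Matrix (Fin N) (Fin N) ℂ :=
  ((Real.exp (-2 * (∑ k, a k) * t) : ℝ) : ℂ) • ρ +
    (((1 - Real.exp (-2 * (∑ k, a k) * t) : ℝ) : ℂ) * ρ.trace) • fixedState a

theorem iterate_diagonalLindbladian {a : Fin N → ℝ} (ha : ∀ k, 0 ≤ a k)
    (ρ : Matrix (Fin N) (Fin N) ℂ) (j : ℕ) :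
    (diagonalLindbladian fun k _ => a k)^[j] ρ =
      ((-2 * ((∑ k, a k : ℝ) : ℂ)) ^ j) • (ρ - ρ.trace • fixedState a) +
        (if j = 0 then ρ.trace • fixedState a else 0) := by
  induction j with
  | zero => simp
  | succ j ih =>
    rw [Function.iterate_succ_apply', ih, diagonalLindbladian_eq_smul ha]
    have hS := sum_mul_trace_fixedState a
    set S : ℂ := ((∑ k, a k : ℝ) : ℂ)
    set T := (fixedState a).trace
    by_cases hj : j = 0
    · subst hj
      simp only [pow_zero, one_smul, if_true, sub_add_cancel, zero_add, pow_one]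
      simp only [one_ne_zero, if_false]
      module
    · simp only [hj, if_false, add_zero, Nat.add_eq_zero_iff, one_ne_zero, and_false,
        Matrix.trace_smul, Matrix.trace_sub, smul_eq_mul]
      -- The deviation from the fixed state is traceless unless `S = 0`.
      have h0 : S * (ρ.trace - ρ.trace * T) = 0 := by linear_combination (-ρ.trace) * hS
      rw [smul_sub, smul_smul]
      rw [show 2 * S * ((-2 * S) ^ j * (ρ.trace - ρ.trace * T)) = 0 by
        linear_combination (2 * (-2 * S) ^ j) * h0]
      rw [pow_succ]
      module

theorem isExp_relaxation {a : Fin N → ℝ} (ha : ∀ k, 0 ≤ a k) (t : ℝ) :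
    IsExp (diagonalLindbladian fun k _ => a k) t (relaxation a t) := by
  intro ρ
  simp only [iterate_diagonalLindbladian ha, smul_add]
  set S : ℝ := ∑ k, a k
  have h1 : HasSum (fun j : ℕ => ((t ^ j / (j.factorial : ℝ) : ℝ) : ℂ) •
      ((-2 * (S : ℂ)) ^ j • (ρ - ρ.trace • fixedState a)))
      (((Real.exp (-2 * S * t) : ℝ) : ℂ) • (ρ - ρ.trace • fixedState a)) := by
    have h : HasSum (fun j : ℕ => (((-2 * S * t) ^ j / (j.factorial : ℝ) : ℝ) : ℂ))
        ((Real.exp (-2 * S * t) : ℝ) : ℂ) := by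
      rw [Real.exp_eq_exp_ℝ]
      exact Complex.hasSum_ofReal.2 (by
        simpa only [smul_eq_mul, div_eq_inv_mul] using
          NormedSpace.exp_series_hasSum_exp' (𝕂 := ℝ) (-2 * S * t))
    have h' := h.smul_const (ρ - ρ.trace • fixedState a)
    refine h'.congr_fun fun j => ?_
    rw [smul_smul]
    congr 1
    push_cast
    ring
  have h2 : HasSum (fun j : ℕ => ((t ^ j / (j.factorial : ℝ) : ℝ) : ℂ) •
      (if j = 0 then ρ.trace • fixedState a else 0)) (ρ.trace • fixedState a) := by
    have := hasSum_ite_eq (0 : ℕ) (ρ.trace • fixedState a)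
    refine this.congr_fun fun j => ?_
    by_cases hj : j = 0 <;> simp [hj]
  have h := h1.add h2
  convert h using 1
  change ((Real.exp (-2 * S * t) : ℝ) : ℂ) • ρ +
    (((1 - Real.exp (-2 * S * t) : ℝ) : ℂ) * ρ.trace) • fixedState a = _
  rw [Complex.ofReal_sub, Complex.ofReal_one]
  module

theorem relaxation_single_self (a : Fin N → ℝ) (t : ℝ) (u : Fin N) :
    relaxation a t (Matrix.single u u 1) =
      ((Real.exp (-2 * (∑ k, a k) * t) : ℝ) : ℂ) • Matrix.single u u (1 : ℂ) +
        ((1 - Real.exp (-2 * (∑ k, a k) * t) : ℝ) : ℂ) • fixedState a := by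
  simp [relaxation]

theorem relaxation_single_of_ne (a : Fin N → ℝ) (t : ℝ) {u v : Fin N} (h : u ≠ v) :
    relaxation a t (Matrix.single u v 1) =
      ((Real.exp (-2 * (∑ k, a k) * t) : ℝ) : ℂ) • Matrix.single u v (1 : ℂ) := by
  simp [relaxation, Matrix.trace_single_eq_of_ne _ _ _ h]

/-- The probability that the system has been reset, to the state `k`, by time `t`. -/
noncomputable def resetProb (a : Fin N → ℝ) (t : ℝ) (k : Fin N) : ℝ :=
  (1 - Real.exp (-2 * (∑ i, a i) * t)) * a k / ∑ i, a i

theorem exp_le_one_of_nonneg {a : Fin N → ℝ} (ha : ∀ k, 0 ≤ a k) {t : ℝ} (ht : 0 < t) :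
    Real.exp (-2 * (∑ i, a i) * t) ≤ 1 := by
  rw [Real.exp_le_one_iff]
  have : 0 ≤ (∑ i, a i) * t := mul_nonneg (Finset.sum_nonneg fun i _ => ha i) ht.le
  linarith

theorem resetProb_nonneg {a : Fin N → ℝ} (ha : ∀ k, 0 ≤ a k) {t : ℝ} (ht : 0 < t) (k : Fin N) :
    0 ≤ resetProb a t k :=
  div_nonneg (mul_nonneg (sub_nonneg.2 (exp_le_one_of_nonneg ha ht)) (ha k))
    (Finset.sum_nonneg fun i _ => ha i)

theorem sum_resetProb (a : Fin N → ℝ) (t : ℝ) :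
    ∑ k, resetProb a t k = 1 - Real.exp (-2 * (∑ i, a i) * t) := by
  unfold resetProb
  rw [← Finset.sum_div, ← Finset.mul_sum]
  by_cases hS : ∑ k, a k = 0
  · simp [hS]
  · rw [mul_div_cancel_right₀ _ hS]

theorem relaxation_eq (a : Fin N → ℝ) (t : ℝ) (ρ : Matrix (Fin N) (Fin N) ℂ) :
    relaxation a t ρ = ((Real.exp (-2 * (∑ k, a k) * t) : ℝ) : ℂ) • ρ +
      ρ.trace • Matrix.diagonal (fun k => (resetProb a t k : ℂ)) := by
  unfold relaxation fixedState resetProb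
  congr 1
  rw [mul_comm, ← smul_smul, ← Matrix.diagonal_smul]
  congr 2
  funext k
  simp only [Pi.smul_apply, smul_eq_mul]
  push_cast
  ring

theorem stinespring_zero (a : Fin N → ℝ) (t : ℝ) (x e m : Fin N) :
    stinespring a t (x, (e, 0)) m =
      if x = m ∧ (e : ℕ) = 0 then ((Real.exp (-(∑ i, a i) * t) : ℝ) : ℂ) else 0 := by
  simp [stinespring]

theorem stinespring_succ (a : Fin N → ℝ) (t : ℝ) (x e j m : Fin N) :
    stinespring a t (x, (e, j.succ)) m =
      if e = x ∧ j = m then ((Real.sqrt (resetProb a t x) : ℝ) : ℂ) else 0 := by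
  simp [stinespring, resetProb, Fin.ext_iff]

theorem star_stinespring (a : Fin N → ℝ) (t : ℝ) (b : Fin N × (Fin N × Fin (N + 1)))
    (m : Fin N) : star (stinespring a t b m) = stinespring a t b m := by
  unfold stinespring
  split_ifs <;> simp [-Complex.ofReal_exp]

theorem exp_mul_exp_ofReal (S t : ℝ) : ((Real.exp (-S * t) : ℝ) : ℂ) *
    ((Real.exp (-S * t) : ℝ) : ℂ) = ((Real.exp (-2 * S * t) : ℝ) : ℂ) := by
  rw [← Complex.ofReal_mul, ← Real.exp_add]
  congr 2
  ring

theorem stinespring_isometry [NeZero N] {a : Fin N → ℝ} (ha : ∀ k, 0 ≤ a k) {t : ℝ}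
    (ht : 0 < t) : (stinespring a t).conjTranspose * stinespring a t = 1 := by
  ext m m'
  have h0 : ∀ e : Fin N, (e : ℕ) = 0 ↔ e = 0 := fun e => Fin.val_eq_zero_iff
  have hs : ∀ k, ((Real.sqrt (resetProb a t k) : ℝ) : ℂ) * ((Real.sqrt (resetProb a t k) : ℝ) : ℂ) =
      (resetProb a t k : ℂ) := fun k => by
    rw [← Complex.ofReal_mul, Real.mul_self_sqrt (resetProb_nonneg ha ht k)]
  simp only [Matrix.mul_apply, Matrix.conjTranspose_apply, star_stinespring,
    Fintype.sum_prod_type,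
    Fin.sum_univ_succ, stinespring_zero, stinespring_succ, h0, ite_and,
    mul_ite, ite_mul, zero_mul, mul_zero, Finset.sum_add_distrib, Finset.sum_ite_eq',
    Finset.mem_univ, if_true, Finset.sum_const_zero, exp_mul_exp_ofReal, hs, Finset.sum_ite_irrel]
  by_cases h : m = m'
  · subst h
    simp only [if_true, Matrix.one_apply_eq, ← Complex.ofReal_sum, sum_resetProb]
    push_cast
    ring
  · simp [h, Ne.symm h]

theorem relaxation_eq_traceAnc [NeZero N] {a : Fin N → ℝ} (ha : ∀ k, 0 ≤ a k) {t : ℝ}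
    (ht : 0 < t) (ρ : Matrix (Fin N) (Fin N) ℂ) :
    relaxation a t ρ =
      traceAnc (stinespring a t * ρ * (stinespring a t).conjTranspose) := by
  ext x y
  have h0 : ∀ e : Fin N, (e : ℕ) = 0 ↔ e = 0 := fun e => Fin.val_eq_zero_iff
  have hs : ((Real.sqrt (resetProb a t x) : ℝ) : ℂ) * ((Real.sqrt (resetProb a t x) : ℝ) : ℂ) =
      (resetProb a t x : ℂ) := by
    rw [← Complex.ofReal_mul, Real.mul_self_sqrt (resetProb_nonneg ha ht x)]
  rw [relaxation_eq]
  simp only [traceAnc, Matrix.mul_apply, Matrix.conjTranspose_apply, star_stinespring,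
    Fintype.sum_prod_type,
    Fin.sum_univ_succ, stinespring_zero, stinespring_succ, h0, ite_and,
    mul_ite, ite_mul, zero_mul, mul_zero, Finset.sum_add_distrib, Finset.sum_ite_eq,
    Finset.sum_ite_eq', Finset.mem_univ, if_true, Finset.sum_const_zero, Finset.sum_ite_irrel]
  simp only [Matrix.add_apply, Matrix.smul_apply, smul_eq_mul, Matrix.diagonal_apply]
  congr 1
  · rw [← exp_mul_exp_ofReal]
    ring
  · by_cases h : x = y
    · subst h
      simp only [if_true, Matrix.trace, Matrix.diag, Finset.sum_mul, ← hs]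
      refine Finset.sum_congr rfl fun i _ => ?_
      ring
    · simp [h, Ne.symm h]

end Semigroup

/-! ### Linearity of circuits -/

section Linearity

variable {n s r : ℕ} (f : ℕ → ℕ → ℝ)

theorem Instr.apply_single (g : Instr n s r) (c : Config n s r) (w : ℂ) :
    g.apply f (Finsupp.single c w) = w • g.onBasis f c := by
  simp [Instr.apply]

theorem Instr.apply_add (g : Instr n s r) (ψ φ : State n s r) :
    g.apply f (ψ + φ) = g.apply f ψ + g.apply f φ :=
  Finsupp.sum_add_index' (fun _ => zero_smul _ _) fun _ _ _ => add_smul _ _ _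

theorem Instr.apply_zero (g : Instr n s r) : g.apply f 0 = 0 :=
  Finsupp.sum_zero_index

theorem Circuit.apply_nil (ψ : State n s r) : Circuit.apply f [] ψ = ψ := rfl

theorem Circuit.apply_cons (g : Instr n s r) (C : Circuit n s r) (ψ : State n s r) :
    Circuit.apply f (g :: C) ψ = Circuit.apply f C (g.apply f ψ) := rfl

theorem Circuit.apply_append (C D : Circuit n s r) (ψ : State n s r) :
    Circuit.apply f (C ++ D) ψ = Circuit.apply f D (Circuit.apply f C ψ) := by
  simp [Circuit.apply, List.foldl_append]

theorem Circuit.apply_add (C : Circuit n s r) (ψ φ : State n s r) :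
    Circuit.apply f C (ψ + φ) = Circuit.apply f C ψ + Circuit.apply f C φ := by
  induction C generalizing ψ φ with
  | nil => rfl
  | cons g C ih => simp only [Circuit.apply_cons, Instr.apply_add, ih]

theorem Circuit.apply_zero (C : Circuit n s r) : Circuit.apply f C 0 = 0 := by
  induction C with
  | nil => rfl
  | cons g C ih => simp only [Circuit.apply_cons, Instr.apply_zero, ih]

theorem Circuit.apply_sum {ι : Type*} (C : Circuit n s r) (A : Finset ι) (ψ : ι → State n s r) :
    Circuit.apply f C (∑ i ∈ A, ψ i) = ∑ i ∈ A, Circuit.apply f C (ψ i) := by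
  classical
  induction A using Finset.induction_on with
  | empty => simp [Circuit.apply_zero]
  | insert i A hi ih => rw [Finset.sum_insert hi, Finset.sum_insert hi, Circuit.apply_add, ih]

end Linearity

/-! ### Layout of the memory, and the instructions on basis states -/

section Layout

variable {n : ℕ}

/-- The ancilla qubit that says whether the system is reset. -/
def flagQubit (n : ℕ) : Fin n ⊕ Fin (2 * n + 1) := Sum.inr 0

/-- The ancilla qubits in which the index of the new state is prepared. -/
def indexQubit (i : Fin n) : Fin n ⊕ Fin (2 * n + 1) := Sum.inr ⟨1 + i, by omega⟩

/-- The ancilla qubits that hold the constant upper end of all queries. -/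
def upperQubit (i : Fin n) : Fin n ⊕ Fin (2 * n + 1) := Sum.inr ⟨1 + n + i, by omega⟩

/-- The real register with number `j`, for `j < 9 * n + 18`. Register `0` holds the time and
registers `1` to `7` serve the flag. The nine registers from `8 + 9 * i` on serve the digit `i` of
the index: seven for its preparation, the last of which is the weight of the index interval that
remains after the digits from `i` on are chosen, and two for its transfer. In the block `i = n` only
the weight is used, for the total rate. -/
def reg (n j : ℕ) : Fin (9 * n + 17 + 1) := Fin.ofNat _ j

/-- Register contents given by a sequence of reals. -/
def regs (n : ℕ) (ζ : ℕ → ℝ) : Regs (9 * n + 17) := fun i => ζ i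

theorem regs_reg (ζ : ℕ → ℝ) {j : ℕ} (hj : j < 9 * n + 18) : regs n ζ (reg n j) = ζ j := by
  simp [regs, reg, Nat.mod_eq_of_lt hj]

theorem reg_ne_reg {j k : ℕ} (hj : j < 9 * n + 18) (hk : k < 9 * n + 18) (h : j ≠ k) :
    reg n j ≠ reg n k := by
  simpa [reg, Fin.ext_iff, Nat.mod_eq_of_lt hj, Nat.mod_eq_of_lt hk] using h

theorem update_regs (ζ : ℕ → ℝ) {j : ℕ} (hj : j < 9 * n + 18) (v : ℝ) :
    Function.update (regs n ζ) (reg n j) v = regs n (Function.update ζ j v) := by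
  funext i
  have h : i = reg n j ↔ (i : ℕ) = j := by simp [reg, Fin.ext_iff, Nat.mod_eq_of_lt hj]
  simp only [Function.update_apply, regs, h]

/-- Qubit contents: `sys` in the system, `b` in the flag, the binary digits of `κ` in the index
qubits and those of `M` in the upper-end qubits. -/
def bits (M : ℕ) (sys : Fin n → Bool) (b : Bool) (κ : ℕ) : Bits n (2 * n + 1) :=
  Sum.elim sys fun q => if (q : ℕ) = 0 then b else
    if (q : ℕ) ≤ n then κ.testBit (q - 1) else M.testBit (q - 1 - n)

/-- The basis state with the given contents, with coefficient `w`. -/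
noncomputable def ket (M : ℕ) (sys : Fin n → Bool) (b : Bool) (κ : ℕ) (ζ : ℕ → ℝ) (w : ℂ) :
    State n (2 * n + 1) (9 * n + 17) :=
  Finsupp.single (bits M sys b κ, regs n ζ) w

theorem bits_inl (M : ℕ) (sys : Fin n → Bool) (b : Bool) (κ : ℕ) (i : Fin n) :
    bits M sys b κ (Sum.inl i) = sys i := rfl

theorem bits_flag (M : ℕ) (sys : Fin n → Bool) (b : Bool) (κ : ℕ) :
    bits M sys b κ (flagQubit n) = b := by
  simp [bits, flagQubit]

theorem bits_index (M : ℕ) (sys : Fin n → Bool) (b : Bool) (κ : ℕ) (i : Fin n) :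
    bits M sys b κ (indexQubit i) = κ.testBit i := by
  have : 1 + (i : ℕ) ≤ n := by omega
  simp [bits, indexQubit, this]

theorem bits_upper (M : ℕ) (sys : Fin n → Bool) (b : Bool) (κ : ℕ) (i : Fin n) :
    bits M sys b κ (upperQubit i) = M.testBit i := by
  have h1 : ¬ 1 + n + (i : ℕ) ≤ n := by omega
  have h2 : 1 + n + (i : ℕ) - 1 - n = i := by omega
  simp [bits, upperQubit, h1, h2]

theorem update_bits_inl (M : ℕ) (sys : Fin n → Bool) (b : Bool) (κ : ℕ) (i : Fin n) (v : Bool) :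
    Function.update (bits M sys b κ) (Sum.inl i) v = bits M (Function.update sys i v) b κ := by
  funext q
  rcases q with q | q
  · simp [bits, Function.update_apply]
  · simp [bits]

theorem update_bits_flag (M : ℕ) (sys : Fin n → Bool) (b : Bool) (κ : ℕ) (v : Bool) :
    Function.update (bits M sys b κ) (flagQubit n) v = bits M sys v κ := by
  funext q
  rcases q with q | q
  · simp [bits, flagQubit]
  · have hq : q = 0 ↔ (q : ℕ) = 0 := by rw [Fin.ext_iff, Fin.val_zero]
    simp only [bits, Function.update_apply, flagQubit, Sum.inr.injEq, hq, Sum.elim_inr]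
    split_ifs <;> rfl

theorem update_bits_index (M : ℕ) (sys : Fin n → Bool) (b : Bool) {κ κ' : ℕ} (i : Fin n) (v : Bool)
    (h : ∀ l, κ'.testBit l = if l = i then v else κ.testBit l) :
    Function.update (bits M sys b κ) (indexQubit i) v = bits M sys b κ' := by
  funext q
  rcases q with q | q
  · simp [bits, indexQubit]
  · simp only [bits, Function.update_apply, indexQubit, Sum.inr.injEq, Fin.ext_iff, Sum.elim_inr]
    by_cases h0 : (q : ℕ) = 0
    · have : ¬ (0 = 1 + (i : ℕ)) := by omega
      simp [h0, this]
    · by_cases h1 : (q : ℕ) ≤ n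
      · have : (q : ℕ) - 1 = i ↔ (q : ℕ) = 1 + i := by omega
        simp [h0, h1, h, this]
      · have : ¬ ((q : ℕ) = 1 + i) := by omega
        simp [h0, h1, this]

theorem elim_injective : Function.Injective
    (Sum.elim indexQubit upperQubit : Fin n ⊕ Fin n → Fin n ⊕ Fin (2 * n + 1)) := by
  rintro (i | i) (j | j) h
  all_goals
    simp only [Sum.elim_inl, Sum.elim_inr, indexQubit, upperQubit, Sum.inr.injEq,
      Fin.mk.injEq] at h
  · exact congrArg Sum.inl (Fin.ext (by omega))
  · omega
  · omega
  · exact congrArg Sum.inr (Fin.ext (by omega))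

/-- The permutation matrix `X ⊗ 1`. -/
def notMatrix : Matrix (Bool × Bool) (Bool × Bool) ℂ :=
  fun y x => if y = (!x.1, x.2) then 1 else 0

/-- The gate `X ⊗ 1`. -/
def notGate : Matrix.unitaryGroup (Bool × Bool) ℂ :=
  ⟨notMatrix, by
    rw [Matrix.mem_unitaryGroup_iff']
    ext ⟨a, b⟩ ⟨c, d⟩
    cases a <;> cases b <;> cases c <;> cases d <;>
      simp [Matrix.mul_apply, notMatrix]⟩

/-- Negation of an ancilla qubit other than the flag. -/
def notInstr (q : Fin n ⊕ Fin (2 * n + 1)) (hq : q ≠ flagQubit n) :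
    Instr n (2 * n + 1) (9 * n + 17) :=
  .gate q (flagQubit n) hq notGate

/-- Query with the index qubits as lower and the upper-end qubits as upper end. -/
def queryInstr (n d : ℕ) (adj : Bool) : Instr n (2 * n + 1) (9 * n + 17) :=
  .query indexQubit upperQubit elim_injective (reg n d) adj

/-- Arithmetic on registers given by their numbers. -/
def arithInstr (op : RealOp) (u v d : ℕ) (adj : Bool)
    (h : u < 9 * n + 18 ∧ v < 9 * n + 18 ∧ d < 9 * n + 18 ∧ u ≠ d ∧ v ≠ d) :
    Instr n (2 * n + 1) (9 * n + 17) :=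
  .arith op (reg n u) (reg n v) (reg n d) (reg_ne_reg h.1 h.2.2.1 h.2.2.2.1)
    (reg_ne_reg h.2.1 h.2.2.1 h.2.2.2.2) adj

variable (f : ℕ → ℕ → ℝ) (M : ℕ) (sys : Fin n → Bool) (b : Bool) (κ : ℕ) (ζ : ℕ → ℝ) (w : ℂ)

theorem apply_notInstr (q : Fin n ⊕ Fin (2 * n + 1)) (hq : q ≠ flagQubit n)
    (c : Config n (2 * n + 1) (9 * n + 17)) :
    (notInstr q hq).apply f (Finsupp.single c w) =
      Finsupp.single (Function.update c.1 q (!c.1 q), c.2) w := by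
  obtain ⟨x, z⟩ := c
  rw [Instr.apply_single]
  unfold notInstr
  change w • (∑ y : Bool × Bool, Finsupp.single (Function.update (Function.update x q y.1)
    (flagQubit n) y.2, z) ((notGate : Matrix _ _ ℂ) y (x q, x (flagQubit n)))) = _
  rw [Finset.sum_eq_single (!x q, x (flagQubit n))]
  · have h : Function.update (Function.update x q (!x q)) (flagQubit n) (x (flagQubit n)) =
        Function.update x q (!x q) := by
      rw [Function.update_comm hq, Function.update_eq_self]
    simp [notGate, notMatrix, h]
  · intro y _ hy
    simp [notGate, notMatrix, hy]
  · simp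

theorem index_ne_flag (i : Fin n) : indexQubit i ≠ flagQubit n := by
  simp [indexQubit, flagQubit, Fin.ext_iff]

theorem upper_ne_flag (i : Fin n) : upperQubit i ≠ flagQubit n := by
  simp only [upperQubit, flagQubit, Fin.ext_iff, ne_eq, Sum.inr.injEq, Fin.val_zero]
  omega

theorem apply_notInstr_index {κ κ' : ℕ} (i : Fin n)
    (h : ∀ l, κ'.testBit l = if l = i then !κ.testBit i else κ.testBit l) :
    (notInstr (indexQubit i) (index_ne_flag i)).apply f (ket M sys b κ ζ w) =
      ket M sys b κ' ζ w := by
  unfold ket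
  rw [apply_notInstr]
  simp only [bits_index, update_bits_index M sys b i _ h]

theorem apply_queryInstr {κ M : ℕ} (hκ : κ < 2 ^ n) (hM : M < 2 ^ n) {d : ℕ}
    (hd : d < 9 * n + 18) (adj : Bool) :
    (queryInstr n d adj).apply f (ket M sys b κ ζ w) =
      ket M sys b κ (Function.update ζ d (ζ d + sgn adj * f κ M)) w := by
  unfold ket
  rw [Instr.apply_single]
  unfold queryInstr Instr.onBasis
  simp only [bits_index, bits_upper, Nat.ofBits_testBit, Nat.mod_eq_of_lt hκ, Nat.mod_eq_of_lt hM,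
    regs_reg ζ hd, update_regs ζ hd, Finsupp.smul_single, smul_eq_mul, mul_one]

theorem apply_arithInstr (op : RealOp) (u v d : ℕ) (adj : Bool) (h) :
    (arithInstr op u v d adj h).apply f (ket M sys b κ ζ w) =
      ket M sys b κ (Function.update ζ d (ζ d + sgn adj * op.eval (ζ u) (ζ v))) w := by
  unfold ket
  rw [Instr.apply_single]
  unfold arithInstr Instr.onBasis
  simp only [regs_reg ζ h.1, regs_reg ζ h.2.1, regs_reg ζ h.2.2.1, update_regs ζ h.2.2.1,
    Finsupp.smul_single, smul_eq_mul, mul_one]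

theorem apply_load (q : Fin n ⊕ Fin (2 * n + 1)) {d : ℕ} (hd : d < 9 * n + 18) (adj : Bool) :
    (Instr.load q (reg n d) adj).apply f (ket M sys b κ ζ w) =
      ket M sys b κ (Function.update ζ d
        (ζ d + sgn adj * (if bits M sys b κ q then 1 else 0))) w := by
  unfold ket
  rw [Instr.apply_single]
  unfold Instr.onBasis
  simp only [regs_reg ζ hd, update_regs ζ hd, Finsupp.smul_single, smul_eq_mul, mul_one]

theorem apply_rot_flag {u : ℕ} (hu : u < 9 * n + 18) :
    (Instr.rot (flagQubit n) (reg n u) false).apply f (ket M sys false κ ζ w) =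
      ket M sys false κ ζ (w * (Real.cos (ζ u) : ℂ)) +
        ket M sys true κ ζ (w * (Real.sin (ζ u) : ℂ)) := by
  unfold ket
  rw [Instr.apply_single]
  unfold Instr.onBasis
  simp only [bits_flag, update_bits_flag, regs_reg ζ hu, Fintype.sum_bool, rotMatrix, sgn, smul_add,
    Finsupp.smul_single, smul_eq_mul, if_false, one_mul, Bool.false_eq_true]
  exact add_comm _ _

theorem apply_rot_index {κ κ' : ℕ} (i : Fin n) (h0 : κ.testBit i = false)
    (h : ∀ l, κ'.testBit l = if l = i then true else κ.testBit l)
    {u : ℕ} (hu : u < 9 * n + 18) :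
    (Instr.rot (indexQubit i) (reg n u) false).apply f (ket M sys b κ ζ w) =
      ket M sys b κ ζ (w * (Real.cos (ζ u) : ℂ)) +
        ket M sys b κ' ζ (w * (Real.sin (ζ u) : ℂ)) := by
  have h1 : ∀ l, κ.testBit l = if l = i then false else κ.testBit l := by
    intro l
    split_ifs with hl
    · rw [hl, h0]
    · rfl
  unfold ket
  rw [Instr.apply_single]
  unfold Instr.onBasis
  simp only [bits_index, h0, Fintype.sum_bool, update_bits_index M sys b i true h,
    update_bits_index M sys b i false h1, regs_reg ζ hu, rotMatrix, sgn, smul_add,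
    Finsupp.smul_single, smul_eq_mul, if_false, one_mul, Bool.false_eq_true]
  exact add_comm _ _

/-- A rotation by `0` or `±π/2` replaces the bit `x` of the system by the bit `v`. -/
theorem apply_rot_sys (i : Fin n) {u : ℕ} (hu : u < 9 * n + 18) (v : Bool)
    (h : ζ u = ((if v then 1 else 0) - (if sys i then 1 else 0)) * (Real.pi / 2)) :
    (Instr.rot (Sum.inl i) (reg n u) false).apply f (ket M sys b κ ζ w) =
      ket M (Function.update sys i v) b κ ζ w := by
  unfold ket
  rw [Instr.apply_single]
  unfold Instr.onBasis
  simp only [bits_inl, Fintype.sum_bool, update_bits_inl, regs_reg ζ hu, sgn, if_false, one_mul,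
    Bool.false_eq_true, h]
  cases v <;> cases sys i <;> simp [rotMatrix]

end Layout

/-! ### Preparation of the index distribution -/

section Preparation

variable {n : ℕ}

theorem testBit_add_two_pow {κ i : ℕ} (h : 2 ^ (i + 1) ∣ κ) (l : ℕ) :
    (κ + 2 ^ i).testBit l = if l = i then true else κ.testBit l := by
  obtain ⟨q, rfl⟩ := h
  have hlt : 2 ^ i < 2 ^ (i + 1) := Nat.pow_lt_pow_right one_lt_two (Nat.lt_succ_self i)
  rw [Nat.testBit_two_pow_mul_add _ hlt, Nat.testBit_two_pow, Nat.testBit_two_pow_mul]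
  by_cases hl : l = i
  · simp [hl]
  · have hl' : ¬ i = l := fun h => hl h.symm
    by_cases hlt' : l < i + 1
    · have : ¬ i + 1 ≤ l := by omega
      simp [hl, hl', hlt', this]
    · have : i + 1 ≤ l := by omega
      simp [hl, hlt', this]

theorem testBit_of_dvd {κ i : ℕ} (h : 2 ^ (i + 1) ∣ κ) : κ.testBit i = false := by
  obtain ⟨q, rfl⟩ := h
  rw [Nat.testBit_two_pow_mul]
  simp

/-- With lower digits of the index `0` and the weight of the index interval in register `c + 15`,
computes the weight of its lower half into `c` and the splitting angle into `c + 3`.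
The lower weight is the difference of the tail sums that start at the two halves, so that
no query has to be clipped to the index range. -/
def angleCircuit (i : Fin n) (c : ℕ) (hc : c + 15 < 9 * n + 18) :
    Circuit n (2 * n + 1) (9 * n + 17) :=
  [queryInstr n c false, notInstr (indexQubit i) (index_ne_flag i), queryInstr n c true,
    notInstr (indexQubit i) (index_ne_flag i),
    arithInstr .div c (c + 15) (c + 1) false (by omega),
    arithInstr .sqrt (c + 1) (c + 1) (c + 2) false (by omega),
    arithInstr .arccos (c + 2) (c + 2) (c + 3) false (by omega)]

/-- Loads the digit `x` of the index, and computes into register `c + 6` the weight of the half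
selected by it, `L + x * (W - 2 * L)`, with `L` in register `c` and `W` in register `c + 15`. -/
def weightCircuit (i : Fin n) (c : ℕ) (hc : c + 15 < 9 * n + 18) :
    Circuit n (2 * n + 1) (9 * n + 17) :=
  [Instr.load (indexQubit i) (reg n (c + 4)) false,
    arithInstr .copy c c (c + 6) false (by omega),
    arithInstr .copy (c + 15) (c + 15) (c + 5) false (by omega),
    arithInstr .copy c c (c + 5) true (by omega),
    arithInstr .copy c c (c + 5) true (by omega),
    arithInstr .mul (c + 4) (c + 5) (c + 6) false (by omega)]

/-- Splits the index interval by one binary digit. -/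
def splitCircuit (i : Fin n) (c : ℕ) (hc : c + 15 < 9 * n + 18) :
    Circuit n (2 * n + 1) (9 * n + 17) :=
  angleCircuit i c hc ++ Instr.rot (indexQubit i) (reg n (c + 3)) false :: weightCircuit i c hc

variable (f : ℕ → ℕ → ℝ)

theorem apply_angleCircuit (i : Fin n) (c : ℕ) (hc : c + 15 < 9 * n + 18) {κ M : ℕ}
    (hκ : 2 ^ ((i : ℕ) + 1) ∣ κ) (hlt : κ + 2 ^ (i : ℕ) < 2 ^ n) (hM : M < 2 ^ n) {ζ : ℕ → ℝ}
    (hζ : ∀ q < 7, ζ (c + q) = 0) (sys : Fin n → Bool) (b : Bool) (w : ℂ) :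
    Circuit.apply f (angleCircuit i c hc) (ket M sys b κ ζ w) =
      ket M sys b κ (Function.update (Function.update (Function.update (Function.update ζ
        c (f κ M - f (κ + 2 ^ (i : ℕ)) M))
        (c + 1) ((f κ M - f (κ + 2 ^ (i : ℕ)) M) / ζ (c + 15)))
        (c + 2) (Real.sqrt ((f κ M - f (κ + 2 ^ (i : ℕ)) M) / ζ (c + 15))))
        (c + 3) (Real.arccos (Real.sqrt ((f κ M - f (κ + 2 ^ (i : ℕ)) M) / ζ (c + 15))))) w := by
  have h1 : ∀ l, (κ + 2 ^ (i : ℕ)).testBit l =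
      if l = (i : ℕ) then !κ.testBit (i : ℕ) else κ.testBit l := by
    rw [testBit_of_dvd hκ]
    exact testBit_add_two_pow hκ
  have h2 : ∀ l, κ.testBit l =
      if l = (i : ℕ) then !(κ + 2 ^ (i : ℕ)).testBit (i : ℕ) else (κ + 2 ^ (i : ℕ)).testBit l := by
    intro l
    rw [h1 l, h1 i]
    by_cases hl : l = (i : ℕ) <;> simp [hl]
  have hκ' : κ < 2 ^ n := lt_of_le_of_lt (Nat.le_add_right _ _) hlt
  have z0 : ζ c = 0 := hζ 0 (by norm_num)
  have z1 := hζ 1 (by norm_num)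
  have z2 := hζ 2 (by norm_num)
  have z3 := hζ 3 (by norm_num)
  have hc' : c < 9 * n + 18 := by omega
  unfold angleCircuit
  simp only [Circuit.apply_cons, Circuit.apply_nil, apply_queryInstr f sys b ζ w hκ' hM hc',
    apply_notInstr_index f M sys b _ w i h1, apply_notInstr_index f M sys b _ w i h2,
    apply_queryInstr f sys b _ w hlt hM hc', apply_arithInstr]
  congr 1
  simp [sgn, RealOp.eval, z0, z1, z2, z3, sub_eq_add_neg]

theorem apply_weightCircuit (i : Fin n) (c : ℕ) (hc : c + 15 < 9 * n + 18) (κ M : ℕ) {ζ : ℕ → ℝ}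
    (h4 : ζ (c + 4) = 0) (h5 : ζ (c + 5) = 0) (h6 : ζ (c + 6) = 0)
    (sys : Fin n → Bool) (b : Bool) (w : ℂ) :
    Circuit.apply f (weightCircuit i c hc) (ket M sys b κ ζ w) =
      ket M sys b κ (Function.update (Function.update (Function.update ζ
        (c + 4) (if κ.testBit i then 1 else 0))
        (c + 5) (ζ (c + 15) - ζ c - ζ c))
        (c + 6) (if κ.testBit i then ζ (c + 15) - ζ c else ζ c)) w := by
  have hc' : c + 4 < 9 * n + 18 := by omega
  unfold weightCircuit
  simp only [Circuit.apply_cons, Circuit.apply_nil, apply_load f M sys b κ _ w _ hc',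
    apply_arithInstr, bits_index]
  congr 1
  funext j
  cases κ.testBit i <;>
    simp only [sgn, RealOp.eval, Function.update_apply, h4, h5, h6, Nat.add_left_cancel_iff,
      Nat.left_eq_add] <;> norm_num <;> split_ifs <;> ring

/-- One digit of the preparation. The contents `ζ₀`, `ζ₁` of the registers and the amplitudes
do not depend on the system and on the flag. -/
theorem apply_splitCircuit (i : Fin n) (c : ℕ) (hc : c + 15 < 9 * n + 18) {κ M : ℕ}
    (hκ : 2 ^ ((i : ℕ) + 1) ∣ κ) (hlt : κ + 2 ^ (i : ℕ) < 2 ^ n) (hM : M < 2 ^ n) {ζ : ℕ → ℝ}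
    (hζ : ∀ q < 7, ζ (c + q) = 0) {L : ℝ} (hL : f κ M - f (κ + 2 ^ (i : ℕ)) M = L) :
    ∃ ζ₀ ζ₁ : ℕ → ℝ,
      (∀ j, j < c ∨ c + 7 ≤ j → ζ₀ j = ζ j ∧ ζ₁ j = ζ j) ∧
      ζ₀ (c + 6) = L ∧ ζ₁ (c + 6) = ζ (c + 15) - L ∧
      ∀ (sys : Fin n → Bool) (b : Bool) (w : ℂ),
        Circuit.apply f (splitCircuit i c hc) (ket M sys b κ ζ w) =
          ket M sys b κ ζ₀
            (w * (Real.cos (Real.arccos (Real.sqrt (L / ζ (c + 15)))) : ℂ)) +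
          ket M sys b (κ + 2 ^ (i : ℕ)) ζ₁
            (w * (Real.sin (Real.arccos (Real.sqrt (L / ζ (c + 15)))) : ℂ)) := by
  have z4 := hζ 4 (by norm_num)
  have z5 := hζ 5 (by norm_num)
  have z6 := hζ 6 (by norm_num)
  have ho : ∀ j, j < c ∨ c + 7 ≤ j → j ≠ c ∧ j ≠ c + 1 ∧ j ≠ c + 2 ∧ j ≠ c + 3 ∧ j ≠ c + 4 ∧
      j ≠ c + 5 ∧ j ≠ c + 6 := fun j hj => by omega
  have hb1 : (κ + 2 ^ (i : ℕ)).testBit i = true := by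
    rw [testBit_add_two_pow hκ]
    simp
  obtain ⟨ζ', hζ'⟩ : ∃ ζ' : ℕ → ℝ, ζ' = Function.update (Function.update (Function.update
      (Function.update ζ c L) (c + 1) (L / ζ (c + 15))) (c + 2) (Real.sqrt (L / ζ (c + 15))))
      (c + 3) (Real.arccos (Real.sqrt (L / ζ (c + 15)))) := ⟨_, rfl⟩
  have hz : ζ' c = L ∧ ζ' (c + 15) = ζ (c + 15) ∧ ζ' (c + 4) = 0 ∧ ζ' (c + 5) = 0 ∧
      ζ' (c + 6) = 0 ∧ ζ' (c + 3) = Real.arccos (Real.sqrt (L / ζ (c + 15))) := by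
    simp [hζ', z4, z5, z6]
  obtain ⟨z0', z15', z4', z5', z6', z3'⟩ := hz
  refine ⟨Function.update (Function.update (Function.update ζ' (c + 4) 0)
      (c + 5) (ζ' (c + 15) - ζ' c - ζ' c)) (c + 6) (ζ' c),
    Function.update (Function.update (Function.update ζ' (c + 4) 1)
      (c + 5) (ζ' (c + 15) - ζ' c - ζ' c)) (c + 6) (ζ' (c + 15) - ζ' c),
    ?_, ?_, ?_, fun sys b w => ?_⟩
  · intro j hj
    obtain ⟨h0, h1, h2, h3, h4, h5, h6⟩ := ho j hj
    simp [hζ', h0, h1, h2, h3, h4, h5, h6]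
  · rw [Function.update_self, z0']
  · rw [Function.update_self, z0', z15']
  · unfold splitCircuit
    rw [Circuit.apply_append, apply_angleCircuit f i c hc hκ hlt hM hζ, hL, ← hζ',
      Circuit.apply_cons, apply_rot_index f M sys b _ w i (testBit_of_dvd hκ)
        (testBit_add_two_pow hκ) (by omega : c + 3 < 9 * n + 18), Circuit.apply_add,
      apply_weightCircuit f i c hc _ _ z4' z5' z6', apply_weightCircuit f i c hc _ _ z4' z5' z6',
      testBit_of_dvd hκ, hb1, z3']
    simp

/-- Splits the index interval by the digits below `j`, from the top. -/
def prepCircuit : (j : ℕ) → j ≤ n → Circuit n (2 * n + 1) (9 * n + 17)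
  | 0, _ => []
  | j + 1, h => splitCircuit ⟨j, h⟩ (8 + 9 * j) (by omega) ++ prepCircuit j (Nat.le_of_succ_le h)

/-- The amplitudes for the two halves of an interval of weight `L + R`. An interval of weight `0`
is harmless: the junk quotient `L / 0 = 0` still gives amplitudes with squares summing to `1`. -/
theorem cos_arccos_sqrt_sq {L R : ℝ} (hL : 0 ≤ L) (hR : 0 ≤ R) :
    (L + R) * Real.cos (Real.arccos (Real.sqrt (L / (L + R)))) ^ 2 = L ∧
      (L + R) * Real.sin (Real.arccos (Real.sqrt (L / (L + R)))) ^ 2 = R := by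
  have h0 : 0 ≤ L / (L + R) := div_nonneg hL (add_nonneg hL hR)
  have h1 : L / (L + R) ≤ 1 := div_le_one_of_le₀ (by linarith) (add_nonneg hL hR)
  have hm : (L + R) * (L / (L + R)) = L := by
    by_cases h : L + R = 0
    · have : L = 0 := by linarith
      simp [this]
    · rw [mul_div_cancel₀ _ h]
  rw [Real.sin_sq, Real.cos_arccos (by linarith [Real.sqrt_nonneg (L / (L + R))])
    (Real.sqrt_le_one.2 h1), Real.sq_sqrt h0]
  exact ⟨hm, by linarith⟩

/-- The preparation turns an interval of weight `W` into a superposition of its indices with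
amplitudes `α k`, `W * α k ^ 2 = g k`. Amplitudes and register contents do not depend on the
system and on the flag. -/
theorem apply_prepCircuit {M : ℕ} (hM : M < 2 ^ n) {g : ℕ → ℝ} (hg : ∀ k, 0 ≤ g k)
    (hf : ∀ κ < 2 ^ n, f κ M = ∑ k ∈ Finset.Ico κ (2 ^ n), g k) (j : ℕ) (hj : j ≤ n) :
    ∀ (κ : ℕ) (ζ : ℕ → ℝ), 2 ^ j ∣ κ → κ + 2 ^ j ≤ 2 ^ n →
      (∀ i < j, ∀ q < 7, ζ (8 + 9 * i + q) = 0) →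
      ζ (8 + 9 * j + 6) = ∑ k ∈ Finset.Ico κ (κ + 2 ^ j), g k →
      ∃ (α : ℕ → ℝ) (Z : ℕ → ℕ → ℝ),
        (∑ k ∈ Finset.Ico κ (κ + 2 ^ j), α k ^ 2 = 1) ∧
        (∀ k ∈ Finset.Ico κ (κ + 2 ^ j), ζ (8 + 9 * j + 6) * α k ^ 2 = g k) ∧
        (∀ k l, (∀ i < j, ∀ q < 7, l ≠ 8 + 9 * i + q) → Z k l = ζ l) ∧
        ∀ (sys : Fin n → Bool) (b : Bool) (w : ℂ),
          Circuit.apply f (prepCircuit j hj) (ket M sys b κ ζ w) =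
            ∑ k ∈ Finset.Ico κ (κ + 2 ^ j), ket M sys b k (Z k) (w * (α k : ℂ)) := by
  induction j with
  | zero =>
    intro κ ζ _ _ _ hW
    have hI : Finset.Ico κ (κ + 2 ^ 0) = {κ} := by simp
    rw [hI, Finset.sum_singleton] at hW
    refine ⟨fun _ => 1, fun _ => ζ, ?_, ?_, fun _ _ _ => rfl, fun sys b w => ?_⟩
    · simp
    · intro k hk
      rw [hI, Finset.mem_singleton] at hk
      rw [hk, hW]
      ring
    · simp [prepCircuit, Circuit.apply_nil]
  | succ j ih =>
    intro κ ζ hκ hle hζ hW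
    have hpow : 2 ^ (j + 1) = 2 ^ j + 2 ^ j := by rw [pow_succ]; ring
    have hpos : 0 < 2 ^ j := by positivity
    have hlt : κ + 2 ^ j < 2 ^ n := by omega
    have hsplit : ∀ h : ℕ → ℝ, ∑ k ∈ Finset.Ico κ (κ + 2 ^ (j + 1)), h k =
        ∑ k ∈ Finset.Ico κ (κ + 2 ^ j), h k +
          ∑ k ∈ Finset.Ico (κ + 2 ^ j) (κ + 2 ^ j + 2 ^ j), h k := fun h => by
      rw [hpow, ← add_assoc, Finset.sum_Ico_consecutive _ (by omega) (by omega)]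
    set L := ∑ k ∈ Finset.Ico κ (κ + 2 ^ j), g k with hLdef
    set R := ∑ k ∈ Finset.Ico (κ + 2 ^ j) (κ + 2 ^ j + 2 ^ j), g k with hRdef
    have hL0 : 0 ≤ L := Finset.sum_nonneg fun k _ => hg k
    have hR0 : 0 ≤ R := Finset.sum_nonneg fun k _ => hg k
    rw [hsplit, ← hLdef, ← hRdef] at hW
    -- The weight register of the block above is number `15` relative to this block.
    have hW' : ζ (8 + 9 * j + 15) = L + R := hW
    have hLf : f κ M - f (κ + 2 ^ j) M = L := by
      rw [hf κ (by omega), hf _ hlt, hLdef,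
        ← Finset.sum_Ico_consecutive g (by omega : κ ≤ κ + 2 ^ j) hlt.le]
      ring
    obtain ⟨ζ₀, ζ₁, hout, h0, h1, happ⟩ := apply_splitCircuit f ⟨j, hj⟩ (8 + 9 * j) (by omega)
      (κ := κ) (M := M) hκ hlt hM (hζ j (Nat.lt_succ_self j)) hLf
    rw [hW', add_sub_cancel_left] at h1
    have hd : 2 ^ j ∣ κ := (pow_dvd_pow 2 (Nat.le_succ j)).trans hκ
    obtain ⟨α₀, Z₀, hs₀, hw₀, hz₀, ha₀⟩ := ih (Nat.le_of_succ_le hj) κ ζ₀ hd hlt.le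
      (fun i hi q hq => by
        rw [(hout _ (by omega)).1, hζ i (by omega) q hq]) h0
    obtain ⟨α₁, Z₁, hs₁, hw₁, hz₁, ha₁⟩ := ih (Nat.le_of_succ_le hj) (κ + 2 ^ j) ζ₁
      (hd.add (dvd_refl _)) (by omega)
      (fun i hi q hq => by
        rw [(hout _ (by omega)).2, hζ i (by omega) q hq]) h1
    set cs := Real.cos (Real.arccos (Real.sqrt (L / ζ (8 + 9 * j + 15)))) with hcs
    set sn := Real.sin (Real.arccos (Real.sqrt (L / ζ (8 + 9 * j + 15)))) with hsn
    obtain ⟨hc2, hs2⟩ := cos_arccos_sqrt_sq hL0 hR0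
    rw [← hW', ← hcs] at hc2
    rw [← hW', ← hsn] at hs2
    have hlow : ∀ k ∈ Finset.Ico κ (κ + 2 ^ j), k < κ + 2 ^ j := fun k hk =>
      (Finset.mem_Ico.1 hk).2
    have hhigh : ∀ k ∈ Finset.Ico (κ + 2 ^ j) (κ + 2 ^ j + 2 ^ j), ¬ k < κ + 2 ^ j := fun k hk =>
      not_lt.2 (Finset.mem_Ico.1 hk).1
    refine ⟨fun k => if k < κ + 2 ^ j then cs * α₀ k else sn * α₁ k,
      fun k => if k < κ + 2 ^ j then Z₀ k else Z₁ k, ?_, ?_, ?_, fun sys b w => ?_⟩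
    · beta_reduce
      rw [hsplit, Finset.sum_congr rfl fun k hk => by rw [if_pos (hlow k hk)],
        Finset.sum_congr (s₁ := Finset.Ico (κ + 2 ^ j) _) rfl
          fun k hk => by rw [if_neg (hhigh k hk)]]
      simp only [mul_pow]
      rw [← Finset.mul_sum, ← Finset.mul_sum, hs₀, hs₁, mul_one, mul_one, hcs, hsn,
        Real.cos_sq_add_sin_sq]
    · intro k hk
      rw [Finset.mem_Ico] at hk
      change ζ (8 + 9 * j + 15) * _ = _
      beta_reduce
      by_cases h : k < κ + 2 ^ j
      · rw [if_pos h, ← hw₀ k (Finset.mem_Ico.2 ⟨hk.1, h⟩), h0]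
        linear_combination α₀ k ^ 2 * hc2
      · rw [if_neg h, ← hw₁ k (Finset.mem_Ico.2 ⟨by omega, by omega⟩), h1]
        linear_combination α₁ k ^ 2 * hs2
    · intro k l hl
      have hl' : l < 8 + 9 * j ∨ 8 + 9 * j + 7 ≤ l := by
        by_contra hc
        exact hl j (Nat.lt_succ_self j) (l - (8 + 9 * j)) (by omega) (by omega)
      by_cases h : k < κ + 2 ^ j
      · simp only [h, if_true]
        rw [hz₀ k l fun i hi => hl i (by omega), (hout l hl').1]
      · simp only [h, if_false]
        rw [hz₁ k l fun i hi => hl i (by omega), (hout l hl').2]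
    · rw [prepCircuit, Circuit.apply_append, happ, Circuit.apply_add, ha₀, ha₁, hpow, ← add_assoc]
      refine Eq.trans ?_ (Finset.sum_Ico_consecutive _ (by omega : κ ≤ κ + 2 ^ j)
        (by omega : κ + 2 ^ j ≤ κ + 2 ^ j + 2 ^ j))
      congr 1
      · refine Finset.sum_congr rfl fun k hk => ?_
        simp only [hlow k hk, if_true, Complex.ofReal_mul, mul_assoc]
      · refine Finset.sum_congr rfl fun k hk => ?_
        simp only [hhigh k hk, if_false, Complex.ofReal_mul, mul_assoc]

theorem length_prepCircuit (j : ℕ) (hj : j ≤ n) : (prepCircuit j hj).length = 14 * j := by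
  induction j with
  | zero => rfl
  | succ j ih =>
    simp only [prepCircuit, splitCircuit, angleCircuit, weightCircuit, List.length_append,
      List.length_cons, List.length_nil, ih]
    ring

end Preparation

/-! ### Conditional transfer of the index to the system -/

section Transfer

variable {n : ℕ}

/-- Rotates the bit `x` of the system by `h * (y - x)`, with `y` the digit of the index and `h`
the content of register `7`. The difference `y - x` is computed in a register from which `x` is
removed again: for `h = 0` nothing may depend on `x`. -/
def transferBit (i : Fin n) (c : ℕ) (hc : c + 8 < 9 * n + 18 ∧ 7 < c) :
    Circuit n (2 * n + 1) (9 * n + 17) :=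
  [Instr.load (indexQubit i) (reg n (c + 7)) false,
    Instr.load (Sum.inl i) (reg n (c + 7)) true,
    arithInstr .mul (c + 7) 7 (c + 8) false (by omega),
    Instr.load (Sum.inl i) (reg n (c + 7)) false,
    Instr.rot (Sum.inl i) (reg n (c + 8)) false]

variable (f : ℕ → ℕ → ℝ)

theorem apply_transferBit (i : Fin n) (c : ℕ) (hc : c + 8 < 9 * n + 18 ∧ 7 < c) (κ M : ℕ)
    {ζ : ℕ → ℝ} (h7 : ζ (c + 7) = 0) (h8 : ζ (c + 8) = 0) (sys : Fin n → Bool) (b : Bool)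
    (hb : ζ 7 = if b then Real.pi / 2 else 0) (w : ℂ) :
    Circuit.apply f (transferBit i c hc) (ket M sys b κ ζ w) =
      ket M (Function.update sys i (if b then κ.testBit i else sys i)) b κ
        (Function.update (Function.update ζ (c + 7) (if κ.testBit i then 1 else 0))
          (c + 8) (((if κ.testBit i then 1 else 0) - (if sys i then 1 else 0)) * ζ 7)) w := by
  have hd7 : c + 7 < 9 * n + 18 := by omega
  unfold transferBit
  simp only [Circuit.apply_cons, Circuit.apply_nil, apply_load f M sys b κ _ w _ hd7,
    apply_arithInstr, bits_index, bits_inl]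
  have hc0 : c ≠ 0 := by omega
  rw [← apply_rot_sys f M sys b κ _ w i hc.1]
  · congr 2
    funext j
    by_cases h1 : j = c + 7
    · simp [sgn, h1, h7, Function.update_apply]
    · by_cases h2 : j = c + 8
      · simp [sgn, RealOp.eval, h2, h7, h8, hc0, sub_eq_add_neg]
        exact Or.inl rfl
      · simp [Function.update_apply, h1, h2]
  · simp only [Function.update_self, hb]
    cases b <;> simp

/-- Transfers the digits below `j`. -/
def transferCircuit : (j : ℕ) → j ≤ n → Circuit n (2 * n + 1) (9 * n + 17)
  | 0, _ => []
  | j + 1, h => transferCircuit j (Nat.le_of_succ_le h) ++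
      transferBit ⟨j, h⟩ (8 + 9 * j) (by omega)

theorem length_transferCircuit (j : ℕ) (hj : j ≤ n) :
    (transferCircuit j hj).length = 5 * j := by
  induction j with
  | zero => rfl
  | succ j ih =>
    simp only [transferCircuit, transferBit, List.length_append, List.length_cons,
      List.length_nil, ih]
    ring

/-- Without the flag the transfer keeps the system, and the final registers do not depend on it. -/
theorem apply_transferCircuit_false (M κ : ℕ) (j : ℕ) (hj : j ≤ n) (ζ : ℕ → ℝ)
    (hζ : ∀ i < n, ζ (8 + 9 * i + 7) = 0 ∧ ζ (8 + 9 * i + 8) = 0) (h7 : ζ 7 = 0) :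
    ∃ ζ' : ℕ → ℝ, (∀ l, l < 8 ∨ 8 + 9 * j ≤ l → ζ' l = ζ l) ∧
      ∀ (sys : Fin n → Bool) (w : ℂ),
        Circuit.apply f (transferCircuit j hj) (ket M sys false κ ζ w) =
          ket M sys false κ ζ' w := by
  induction j with
  | zero => exact ⟨ζ, fun _ _ => rfl, fun _ _ => rfl⟩
  | succ j ih =>
    obtain ⟨ζ', hout, happ⟩ := ih (Nat.le_of_succ_le hj)
    have hz := hζ j hj
    have h7' : ζ' 7 = 0 := by rw [hout 7 (by omega), h7]
    refine ⟨Function.update (Function.update ζ' (8 + 9 * j + 7)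
      (if κ.testBit j then 1 else 0)) (8 + 9 * j + 8) 0, ?_, fun sys w => ?_⟩
    · intro l hl
      have h1 : l ≠ 8 + 9 * j + 8 := by omega
      have h2 : l ≠ 8 + 9 * j + 7 := by omega
      rw [Function.update_of_ne h1, Function.update_of_ne h2, hout l (by omega)]
    · rw [transferCircuit, Circuit.apply_append, happ,
        apply_transferBit f ⟨j, hj⟩ _ _ κ M (by rw [hout _ (by omega), hz.1])
          (by rw [hout _ (by omega), hz.2]) sys false (by simp [h7']), h7', mul_zero]
      simp

/-- With the flag the transfer replaces the system by the index. What it replaces can be read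
off from the registers. -/
theorem apply_transferCircuit_true (M κ : ℕ) (sys : Fin n → Bool) (j : ℕ) (hj : j ≤ n)
    (ζ : ℕ → ℝ) (hζ : ∀ i < n, ζ (8 + 9 * i + 7) = 0 ∧ ζ (8 + 9 * i + 8) = 0)
    (h7 : ζ 7 = Real.pi / 2) :
    ∃ ζ' : ℕ → ℝ, (∀ l, l < 8 ∨ 8 + 9 * j ≤ l → ζ' l = ζ l) ∧
      (∀ i : Fin n, (i : ℕ) < j → ζ' (8 + 9 * i + 8) =
        ((if κ.testBit i then 1 else 0) - (if sys i then 1 else 0)) * (Real.pi / 2)) ∧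
      ∀ w : ℂ, Circuit.apply f (transferCircuit j hj) (ket M sys true κ ζ w) =
        ket M (fun i => if (i : ℕ) < j then κ.testBit i else sys i) true κ ζ' w := by
  induction j with
  | zero => exact ⟨ζ, fun _ _ => rfl, fun _ h => absurd h (Nat.not_lt_zero _), fun _ => by
      simp [transferCircuit, Circuit.apply_nil]⟩
  | succ j ih =>
    obtain ⟨ζ', hout, hrec, happ⟩ := ih (Nat.le_of_succ_le hj)
    have hz := hζ j hj
    have h7' : ζ' 7 = Real.pi / 2 := by rw [hout 7 (by omega), h7]
    refine ⟨Function.update (Function.update ζ' (8 + 9 * j + 7)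
      (if κ.testBit j then 1 else 0)) (8 + 9 * j + 8)
      (((if κ.testBit j then 1 else 0) - (if sys ⟨j, hj⟩ then 1 else 0)) * (Real.pi / 2)),
      ?_, ?_, fun w => ?_⟩
    · intro l hl
      have h1 : l ≠ 8 + 9 * j + 8 := by omega
      have h2 : l ≠ 8 + 9 * j + 7 := by omega
      rw [Function.update_of_ne h1, Function.update_of_ne h2, hout l (by omega)]
    · intro i hi
      by_cases hij : (i : ℕ) = j
      · have : i = ⟨j, hj⟩ := Fin.ext hij
        rw [this, Function.update_self]
      · have h1 : 8 + 9 * (i : ℕ) + 8 ≠ 8 + 9 * j + 8 := by omega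
        have h2 : 8 + 9 * (i : ℕ) + 8 ≠ 8 + 9 * j + 7 := by omega
        rw [Function.update_of_ne h1, Function.update_of_ne h2, hrec i (by omega)]
    · rw [transferCircuit, Circuit.apply_append, happ,
        apply_transferBit f ⟨j, hj⟩ _ _ κ M (by rw [hout _ (by omega), hz.1])
          (by rw [hout _ (by omega), hz.2]) _ true (by simp [h7']), h7']
      have hsys : Function.update (fun i : Fin n => if (i : ℕ) < j then κ.testBit i else sys i)
          ⟨j, hj⟩ (κ.testBit j) = fun i : Fin n => if (i : ℕ) < j + 1 then κ.testBit i else sys i := by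
        funext i
        by_cases hij : (i : ℕ) = j
        · have : i = ⟨j, hj⟩ := Fin.ext hij
          simp [this]
        · have h1 : i ≠ ⟨j, hj⟩ := fun h => hij (congrArg Fin.val h)
          have h2 : (i : ℕ) < j + 1 ↔ (i : ℕ) < j := by omega
          simp [Function.update_of_ne h1, h2]
      simp only [if_true, hsys, lt_irrefl, if_false]

end Transfer

/-! ### The circuit -/

section MainCircuit

variable {n : ℕ}

theorem eq_of_testBit_fin_eq {κ κ' : ℕ} (hκ : κ < 2 ^ n) (hκ' : κ' < 2 ^ n)
    (h : ∀ i : Fin n, κ.testBit i = κ'.testBit i) : κ = κ' := by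
  rw [← Nat.mod_eq_of_lt hκ, ← Nat.mod_eq_of_lt hκ', ← Nat.ofBits_testBit, ← Nat.ofBits_testBit]
  simp only [h]

theorem update_bits_upper {M M' : ℕ} (sys : Fin n → Bool) (b : Bool) (κ : ℕ) (i : Fin n) (v : Bool)
    (h : ∀ l, M'.testBit l = if l = i then v else M.testBit l) :
    Function.update (bits M sys b κ) (upperQubit i) v = bits M' sys b κ := by
  funext q
  rcases q with q | q
  · simp [bits, upperQubit]
  · simp only [bits, Function.update_apply, upperQubit, Sum.inr.injEq, Fin.ext_iff, Sum.elim_inr]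
    by_cases h1 : (q : ℕ) ≤ n
    · have : ¬ ((q : ℕ) = 1 + n + i) := by omega
      simp [h1, this]
    · have h0 : ¬ ((q : ℕ) = 0) := by omega
      have : (q : ℕ) - 1 - n = i ↔ (q : ℕ) = 1 + n + i := by omega
      simp only [h0, h1, h, this, if_false]

/-- Writes the digits of `M` below `j` into the upper-end qubits. -/
def upperCircuit (M : ℕ) : (j : ℕ) → j ≤ n → Circuit n (2 * n + 1) (9 * n + 17)
  | 0, _ => []
  | j + 1, h => upperCircuit M j (Nat.le_of_succ_le h) ++
      if M.testBit j then [notInstr (upperQubit ⟨j, h⟩) (upper_ne_flag _)] else []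

theorem length_upperCircuit (M j : ℕ) (hj : j ≤ n) : (upperCircuit M j hj).length ≤ j := by
  induction j with
  | zero => exact le_refl 0
  | succ j ih =>
    rw [upperCircuit, List.length_append]
    refine add_le_add (ih _) ?_
    split_ifs <;> simp

variable (f : ℕ → ℕ → ℝ)

theorem apply_upperCircuit (M : ℕ) (sys : Fin n → Bool) (b : Bool) (κ : ℕ) (ζ : ℕ → ℝ) (w : ℂ)
    (j : ℕ) (hj : j ≤ n) :
    Circuit.apply f (upperCircuit M j hj) (ket 0 sys b κ ζ w) = ket (M % 2 ^ j) sys b κ ζ w := by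
  induction j with
  | zero => simp [upperCircuit, Circuit.apply_nil, Nat.mod_one]
  | succ j ih =>
    rw [upperCircuit, Circuit.apply_append, ih]
    have hbit : ∀ l, (M % 2 ^ (j + 1)).testBit l =
        if l = j then M.testBit j else (M % 2 ^ j).testBit l := by
      intro l
      simp only [Nat.testBit_mod_two_pow]
      by_cases hl : l = j
      · simp [hl]
      · have : l < j + 1 ↔ l < j := by omega
        simp [hl, this]
    cases hM : M.testBit j with
    | false =>
      rw [if_neg (by simp), Circuit.apply_nil]
      congr 1
      refine Nat.eq_of_testBit_eq fun l => ?_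
      rw [hbit, hM]
      split_ifs with hl
      · simp [hl]
      · rfl
    | true =>
      rw [if_pos rfl, Circuit.apply_cons, Circuit.apply_nil]
      unfold ket
      rw [apply_notInstr]
      have h0 : (M % 2 ^ j).testBit j = false := by simp
      rw [hM] at hbit
      simp only [bits_upper, h0, Bool.not_false,
        update_bits_upper sys b κ ⟨j, hj⟩ true hbit]

/-- Queries the total rate into register `9 * n + 14`, and rotates the flag by the angle with
cosine `e^{-St}`. -/
def flagCircuit (n : ℕ) : Circuit n (2 * n + 1) (9 * n + 17) :=
  [queryInstr n (9 * n + 14) false,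
    arithInstr .mul (9 * n + 14) 0 2 true (by omega),
    arithInstr .exp 2 2 3 false (by omega),
    arithInstr .arccos 3 3 4 false (by omega),
    Instr.rot (flagQubit n) (reg n 4) false]

/-- Computes `π / 2 = arccos 0` times the flag into register `7`. -/
def angleFlagCircuit (n : ℕ) : Circuit n (2 * n + 1) (9 * n + 17) :=
  [arithInstr .arccos 5 5 6 false (by omega),
    Instr.load (flagQubit n) (reg n 5) false,
    arithInstr .mul 5 6 7 false (by omega)]

/-- The circuit: a flag that is set with probability `1 - e^{-2St}`, a fresh sample of the
fixed state, and the transfer of the sample to the system if the flag is set. -/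
def mainCircuit (n M : ℕ) : Circuit n (2 * n + 1) (9 * n + 17) :=
  upperCircuit M n le_rfl ++ (flagCircuit n ++ (prepCircuit n le_rfl ++
    (angleFlagCircuit n ++ transferCircuit n le_rfl)))

theorem length_mainCircuit (n M : ℕ) : (mainCircuit n M).length ≤ 20 * n + 8 := by
  have h := length_upperCircuit M n le_rfl
  simp only [mainCircuit, List.length_append, length_prepCircuit, length_transferCircuit,
    flagCircuit, angleFlagCircuit, List.length_cons, List.length_nil]
  omega

theorem apply_flagCircuit {M : ℕ} (hM : M < 2 ^ n) {S : ℝ} (hS : f 0 M = S) {ζ : ℕ → ℝ}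
    (hζ : ∀ l ≠ 0, ζ l = 0) :
    ∃ ζ' : ℕ → ℝ, (∀ l, 4 < l → l ≠ 9 * n + 14 → ζ' l = 0) ∧ ζ' (9 * n + 14) = S ∧
      ∀ sys : Fin n → Bool, Circuit.apply f (flagCircuit n) (ket M sys false 0 ζ 1) =
        ket M sys false 0 ζ' (Real.cos (Real.arccos (Real.exp (-(S * ζ 0)))) : ℂ) +
          ket M sys true 0 ζ' (Real.sin (Real.arccos (Real.exp (-(S * ζ 0)))) : ℂ) := by
  have z2 := hζ 2 (by norm_num)
  have z3 := hζ 3 (by norm_num)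
  have z4 := hζ 4 (by norm_num)
  have zS := hζ (9 * n + 14) (by omega)
  have hS' : 9 * n + 14 < 9 * n + 18 := by omega
  obtain ⟨ζ', hζ'⟩ : ∃ ζ' : ℕ → ℝ, ζ' = Function.update (Function.update (Function.update
      (Function.update ζ (9 * n + 14) S) 2 (-(S * ζ 0))) 3 (Real.exp (-(S * ζ 0)))) 4
      (Real.arccos (Real.exp (-(S * ζ 0)))) := ⟨_, rfl⟩
  have h4 : ζ' 4 = Real.arccos (Real.exp (-(S * ζ 0))) := by rw [hζ', Function.update_self]
  refine ⟨ζ', ?_, ?_, fun sys => ?_⟩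
  · intro l hl hlS
    have h2 : l ≠ 2 := by omega
    have h3 : l ≠ 3 := by omega
    have h4 : l ≠ 4 := by omega
    simp [hζ', h2, h3, h4, hlS, hζ l (by omega)]
  · simp [hζ']
  · rw [← h4]
    have hrot := apply_rot_flag f M sys 0 ζ' 1 (by omega : 4 < 9 * n + 18)
    rw [one_mul, one_mul] at hrot
    rw [← hrot]
    unfold flagCircuit
    simp only [Circuit.apply_cons, Circuit.apply_nil, apply_arithInstr,
      apply_queryInstr f sys false ζ 1 (Nat.two_pow_pos n) hM hS', hS]
    congr 2
    simp [hζ', sgn, RealOp.eval, z2, z3, z4, zS]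

theorem apply_angleFlagCircuit (M κ : ℕ) {ζ : ℕ → ℝ} (h5 : ζ 5 = 0) (h6 : ζ 6 = 0)
    (h7 : ζ 7 = 0) (sys : Fin n → Bool) (b : Bool) (w : ℂ) :
    Circuit.apply f (angleFlagCircuit n) (ket M sys b κ ζ w) =
      ket M sys b κ (Function.update (Function.update (Function.update ζ 6 (Real.pi / 2))
        5 (if b then 1 else 0)) 7 (if b then Real.pi / 2 else 0)) w := by
  have hd : 5 < 9 * n + 18 := by omega
  unfold angleFlagCircuit
  simp only [Circuit.apply_cons, Circuit.apply_nil, apply_arithInstr,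
    apply_load f M sys b κ _ w _ hd, bits_flag]
  congr 1
  cases b <;> simp [sgn, RealOp.eval, h5, h6, h7]

/-- The final state. In the branch without the flag the ancilla is independent of the
system. In the other branch the system is the sample `k`, and the ancilla determines both `k` and
the former contents of the system. -/
theorem apply_mainCircuit {M : ℕ} (hM : M < 2 ^ n) {g : ℕ → ℝ} (hg : ∀ k, 0 ≤ g k)
    (hf : ∀ κ < 2 ^ n, f κ M = ∑ k ∈ Finset.Ico κ (2 ^ n), g k) {S : ℝ}
    (hS : ∑ k ∈ Finset.range (2 ^ n), g k = S) {ζ : ℕ → ℝ} (hζ : ∀ l ≠ 0, ζ l = 0) :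
    ∃ (α : ℕ → ℝ) (Z₀ : ℕ → ℕ → ℝ) (Z₁ : ℕ → (Fin n → Bool) → ℕ → ℝ),
      (∑ k ∈ Finset.range (2 ^ n), α k ^ 2 = 1) ∧
      (∀ k ∈ Finset.range (2 ^ n), S * α k ^ 2 = g k) ∧
      (∀ k x y, regs n (Z₁ k x) = regs n (Z₁ k y) → x = y) ∧
      ∀ sys : Fin n → Bool, Circuit.apply f (mainCircuit n M) (ket 0 sys false 0 ζ 1) =
        ∑ k ∈ Finset.range (2 ^ n),
          (ket M sys false k (Z₀ k)
            ((Real.cos (Real.arccos (Real.exp (-(S * ζ 0)))) : ℂ) * (α k : ℂ)) +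
          ket M (fun i => k.testBit i) true k (Z₁ k sys)
            ((Real.sin (Real.arccos (Real.exp (-(S * ζ 0)))) : ℂ) * (α k : ℂ))) := by
  have hIco : Finset.Ico 0 (0 + 2 ^ n) = Finset.range (2 ^ n) := by
    rw [zero_add, Finset.range_eq_Ico]
  have hpos : 0 < 2 ^ n := Nat.two_pow_pos n
  obtain ⟨ζ', hz, hzS, hflag⟩ := apply_flagCircuit f hM (S := S)
    (by rw [hf 0 hpos, ← hS, Finset.range_eq_Ico]) hζ
  have hidx : 8 + 9 * n + 6 = 9 * n + 14 := by omega
  obtain ⟨α, Z, hsum, hw, hZ, hprep⟩ := apply_prepCircuit f hM hg hf n le_rfl 0 ζ'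
    (dvd_zero _) (by rw [zero_add])
    (fun i hi q hq => hz _ (by omega) (by omega)) (by rw [hidx, hzS, hIco, hS])
  rw [hIco] at hsum hw
  rw [hidx, hzS] at hw
  have hZ0 : ∀ k l, 4 < l → l ≠ 9 * n + 14 → (∀ i < n, ∀ q < 7, l ≠ 8 + 9 * i + q) →
      Z k l = 0 := fun k l h1 h2 h3 => by rw [hZ k l h3, hz l h1 h2]
  have h5 : ∀ k, Z k 5 = 0 := fun k =>
    hZ0 k 5 (by omega) (by omega) fun i _ q _ => by omega
  have h6 : ∀ k, Z k 6 = 0 := fun k =>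
    hZ0 k 6 (by omega) (by omega) fun i _ q _ => by omega
  have h7 : ∀ k, Z k 7 = 0 := fun k =>
    hZ0 k 7 (by omega) (by omega) fun i _ q _ => by omega
  have hY : ∀ (k : ℕ) (b : Bool), ∀ i < n,
      Function.update (Function.update (Function.update (Z k) 6 (Real.pi / 2))
        5 (if b then 1 else 0)) 7 (if b then Real.pi / 2 else 0) (8 + 9 * i + 7) = 0 ∧
      Function.update (Function.update (Function.update (Z k) 6 (Real.pi / 2))
        5 (if b then 1 else 0)) 7 (if b then Real.pi / 2 else 0) (8 + 9 * i + 8) = 0 := by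
    intro k b i hi
    constructor
    · rw [Function.update_of_ne (by omega), Function.update_of_ne (by omega),
        Function.update_of_ne (by omega), hZ0 k _ (by omega) (by omega) fun j _ q _ => by omega]
    · rw [Function.update_of_ne (by omega), Function.update_of_ne (by omega),
        Function.update_of_ne (by omega), hZ0 k _ (by omega) (by omega) fun j _ q _ => by omega]
  -- `Z₀` is chosen before the system, `Z₁` after it.
  choose Z₀ _ hZ₀ using fun k => apply_transferCircuit_false f M k n le_rfl _ (hY k false)
    (by rw [Function.update_self, if_neg Bool.false_ne_true])
  choose Z₁ _ hrec hZ₁ using fun k sys => apply_transferCircuit_true f M k sys n le_rfl _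
    (hY k true) (by rw [Function.update_self, if_pos rfl])
  refine ⟨α, Z₀, Z₁, hsum, hw, ?_, fun sys => ?_⟩
  · intro k x y h
    funext i
    have hi : 8 + 9 * (i : ℕ) + 8 < 9 * n + 18 := by omega
    have h' := congrFun h (reg n (8 + 9 * (i : ℕ) + 8))
    rw [regs_reg _ hi, regs_reg _ hi, hrec k x i i.2, hrec k y i i.2] at h'
    have h'' := sub_right_inj.1 (mul_right_cancel₀ (div_ne_zero Real.pi_ne_zero two_ne_zero) h')
    cases hx : x i <;> cases hy : y i <;> simp [hx, hy] at h'' ⊢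
  · unfold mainCircuit
    rw [Circuit.apply_append, apply_upperCircuit, Nat.mod_eq_of_lt hM, Circuit.apply_append,
      hflag, Circuit.apply_append, Circuit.apply_add, hprep, hprep, hIco, ← Finset.sum_add_distrib,
      Circuit.apply_sum]
    refine Finset.sum_congr rfl fun k _ => ?_
    rw [Circuit.apply_add, Circuit.apply_append, Circuit.apply_append,
      apply_angleFlagCircuit f M k (h5 k) (h6 k) (h7 k),
      apply_angleFlagCircuit f M k (h5 k) (h6 k) (h7 k), hZ₀, hZ₁]
    simp only [Fin.is_lt, if_true]

end MainCircuit

/-! ### Tracing out the ancilla -/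

section Reduced

theorem reduced_support_finite {n s r : ℕ} (ψ φ : State n s r) (x y : Fin n → Bool) :
    (Function.support fun e : (Fin s → Bool) × Regs r =>
      ψ (Sum.elim x e.1, e.2) * star (φ (Sum.elim y e.1, e.2))).Finite := by
  have hinj : Function.Injective fun e : (Fin s → Bool) × Regs r =>
      ((Sum.elim x e.1, e.2) : Config n s r) := by
    rintro ⟨e, z⟩ ⟨e', z'⟩ h
    simp only [Prod.mk.injEq] at h ⊢
    exact ⟨by simpa using congrArg (fun u => u ∘ Sum.inr) h.1, h.2⟩
  refine (ψ.support.finite_toSet.preimage hinj.injOn).subset fun e he => ?_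
  rw [Function.mem_support] at he
  simpa using left_ne_zero_of_mul he

variable {n s r : ℕ}

theorem reduced_add_left (ψ ψ' φ : State n s r) :
    reduced (ψ + ψ') φ = reduced ψ φ + reduced ψ' φ := by
  ext x y
  simp only [reduced, Matrix.add_apply]
  rw [← finsum_add_distrib (reduced_support_finite ψ φ x y) (reduced_support_finite ψ' φ x y)]
  simp only [Finsupp.add_apply, add_mul]

theorem reduced_add_right (ψ φ φ' : State n s r) :
    reduced ψ (φ + φ') = reduced ψ φ + reduced ψ φ' := by
  ext x y
  simp only [reduced, Matrix.add_apply]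
  rw [← finsum_add_distrib (reduced_support_finite ψ φ x y) (reduced_support_finite ψ φ' x y)]
  simp only [Finsupp.add_apply, star_add, mul_add]

theorem reduced_sum_left {ι : Type*} (A : Finset ι) (ψ : ι → State n s r) (φ : State n s r) :
    reduced (∑ i ∈ A, ψ i) φ = ∑ i ∈ A, reduced (ψ i) φ := by
  classical
  induction A using Finset.induction_on with
  | empty => ext x y; simp [reduced]
  | insert i A hi ih => rw [Finset.sum_insert hi, Finset.sum_insert hi, reduced_add_left, ih]

theorem reduced_sum_right {ι : Type*} (A : Finset ι) (ψ : State n s r) (φ : ι → State n s r) :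
    reduced ψ (∑ i ∈ A, φ i) = ∑ i ∈ A, reduced ψ (φ i) := by
  classical
  induction A using Finset.induction_on with
  | empty => ext x y; simp [reduced]
  | insert i A hi ih => rw [Finset.sum_insert hi, Finset.sum_insert hi, reduced_add_right, ih]

theorem reduced_single_self (x y : Fin n → Bool) (e : Fin s → Bool) (z : Regs r) (w w' : ℂ) :
    reduced (Finsupp.single (Sum.elim x e, z) w) (Finsupp.single (Sum.elim y e, z) w') =
      Matrix.single x y (w * star w') := by
  ext x' y'
  unfold reduced
  rw [finsum_eq_single _ (e, z)]
  · simp only [Finsupp.single_apply, Prod.mk.injEq, and_true, Matrix.single_apply,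
      Sum.elim_eq_iff]
    by_cases h1 : x = x' <;> by_cases h2 : y = y' <;> simp [h1, h2]
  · rintro ⟨e', z'⟩ h
    have : ¬ (e = e' ∧ z = z') := fun h' => h (by rw [h'.1, h'.2])
    have : ((Sum.elim x e, z) : Config n s r) ≠ (Sum.elim x' e', z') := fun h' =>
      this ⟨by simpa using congrArg (fun u => u.1 ∘ Sum.inr) h', congrArg Prod.snd h'⟩
    simp [Finsupp.single_eq_of_ne this.symm]

theorem reduced_single_of_ne (x y : Fin n → Bool) {e e' : Fin s → Bool} {z z' : Regs r}
    (h : e = e' → z ≠ z') (w w' : ℂ) :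
    reduced (Finsupp.single (Sum.elim x e, z) w) (Finsupp.single (Sum.elim y e', z') w') = 0 := by
  ext x' y'
  unfold reduced
  rw [Matrix.zero_apply]
  refine finsum_eq_zero_of_forall_eq_zero fun u => ?_
  by_cases h1 : ((Sum.elim x e, z) : Config n s r) = (Sum.elim x' u.1, u.2)
  · have h2 : ((Sum.elim y e', z') : Config n s r) ≠ (Sum.elim y' u.1, u.2) := fun h2 => by
      have a1 : e = u.1 := by simpa using congrArg (fun v => v.1 ∘ Sum.inr) h1
      have a2 : e' = u.1 := by simpa using congrArg (fun v => v.1 ∘ Sum.inr) h2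
      exact h (a1.trans a2.symm) ((congrArg Prod.snd h1).trans (congrArg Prod.snd h2).symm)
    simp [Finsupp.single_eq_of_ne h2.symm]
  · simp [Finsupp.single_eq_of_ne (Ne.symm h1)]

theorem reduced_ket_self (M : ℕ) (x y : Fin n → Bool) (b : Bool) (κ : ℕ) (ζ : ℕ → ℝ) (w w' : ℂ) :
    reduced (ket M x b κ ζ w) (ket M y b κ ζ w') = Matrix.single x y (w * star w') :=
  reduced_single_self _ _ _ _ _ _

theorem reduced_ket_of_flag_ne (M : ℕ) (x y : Fin n → Bool) {b b' : Bool} (h : b ≠ b') (κ κ' : ℕ)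
    (ζ ζ' : ℕ → ℝ) (w w' : ℂ) : reduced (ket M x b κ ζ w) (ket M y b' κ' ζ' w') = 0 :=
  reduced_single_of_ne _ _ (fun he => absurd (congrFun he 0) (by simpa using h)) _ _

theorem reduced_ket_of_index_ne (M : ℕ) (x y : Fin n → Bool) (b b' : Bool) {κ κ' : ℕ}
    (hκ : κ < 2 ^ n) (hκ' : κ' < 2 ^ n) (h : κ ≠ κ')
    (ζ ζ' : ℕ → ℝ) (w w' : ℂ) : reduced (ket M x b κ ζ w) (ket M y b' κ' ζ' w') = 0 := by
  refine reduced_single_of_ne _ _ (fun he => absurd ?_ h) _ _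
  refine eq_of_testBit_fin_eq hκ hκ' fun i => ?_
  have h1 : 1 + (i : ℕ) ≤ n := by omega
  simpa [h1] using congrFun he ⟨1 + i, by omega⟩

theorem reduced_ket_of_regs_ne (M : ℕ) (x y : Fin n → Bool) (b b' : Bool) (κ κ' : ℕ)
    {ζ ζ' : ℕ → ℝ} (h : regs n ζ ≠ regs n ζ') (w w' : ℂ) :
    reduced (ket M x b κ ζ w) (ket M y b' κ' ζ' w') = 0 :=
  reduced_single_of_ne _ _ (fun _ => h) _ _

/-- The partial trace of the final states: coherences survive only in the branch without the
flag. -/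
theorem reduced_final (M : ℕ) {α : ℕ → ℝ} {Z₀ : ℕ → ℕ → ℝ} {Z₁ : ℕ → (Fin n → Bool) → ℕ → ℝ}
    (hα : ∑ k ∈ Finset.range (2 ^ n), α k ^ 2 = 1)
    (hZ : ∀ k x y, regs n (Z₁ k x) = regs n (Z₁ k y) → x = y) (c d : ℝ) (x y : Fin n → Bool) :
    reduced
      (∑ k ∈ Finset.range (2 ^ n), (ket M x false k (Z₀ k) ((c : ℂ) * (α k : ℂ)) +
        ket M (fun i => k.testBit i) true k (Z₁ k x) ((d : ℂ) * (α k : ℂ))))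
      (∑ k ∈ Finset.range (2 ^ n), (ket M y false k (Z₀ k) ((c : ℂ) * (α k : ℂ)) +
        ket M (fun i => k.testBit i) true k (Z₁ k y) ((d : ℂ) * (α k : ℂ)))) =
      ((c ^ 2 : ℝ) : ℂ) • Matrix.single x y 1 +
        if x = y then ∑ k ∈ Finset.range (2 ^ n), ((d ^ 2 * α k ^ 2 : ℝ) : ℂ) •
          Matrix.single (fun i : Fin n => k.testBit i) (fun i : Fin n => k.testBit i) 1 else 0 := by
  have hterm : ∀ k ∈ Finset.range (2 ^ n), reduced
      (ket M x false k (Z₀ k) ((c : ℂ) * (α k : ℂ)) +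
        ket M (fun i => k.testBit i) true k (Z₁ k x) ((d : ℂ) * (α k : ℂ)))
      (∑ k ∈ Finset.range (2 ^ n), (ket M y false k (Z₀ k) ((c : ℂ) * (α k : ℂ)) +
        ket M (fun i => k.testBit i) true k (Z₁ k y) ((d : ℂ) * (α k : ℂ)))) =
      ((c ^ 2 * α k ^ 2 : ℝ) : ℂ) • Matrix.single x y 1 +
        if x = y then ((d ^ 2 * α k ^ 2 : ℝ) : ℂ) •
          Matrix.single (fun i : Fin n => k.testBit i) (fun i : Fin n => k.testBit i) 1 else 0 := by
    intro k hk
    rw [reduced_sum_right, Finset.sum_eq_single_of_mem k hk]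
    · rw [reduced_add_left, reduced_add_right, reduced_add_right,
        reduced_ket_of_flag_ne M _ _ Bool.false_ne_true,
        reduced_ket_of_flag_ne M _ _ Bool.false_ne_true.symm, add_zero, zero_add,
        reduced_ket_self]
      congr 1
      · rw [Matrix.smul_single]
        congr 1
        simp
        ring
      · split_ifs with hxy
        · rw [hxy, reduced_ket_self, Matrix.smul_single]
          congr 1
          simp
          ring
        · exact reduced_ket_of_regs_ne M _ _ _ _ _ _ (fun h => hxy (hZ k x y h)) _ _
    · intro l hl hlk
      have hk' := Finset.mem_range.1 hk
      have hl' := Finset.mem_range.1 hl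
      simp only [reduced_add_left, reduced_add_right,
        reduced_ket_of_index_ne M _ _ _ _ hk' hl' hlk.symm, add_zero]
  rw [reduced_sum_left, Finset.sum_congr rfl hterm, Finset.sum_add_distrib, ← Finset.sum_smul,
    ← Complex.ofReal_sum, ← Finset.mul_sum, hα, mul_one]
  congr 1
  split_ifs
  · rfl
  · exact Finset.sum_const_zero

end Reduced

/-! ### The simulation -/

section Simulation

variable {N : ℕ}

/-- The rates as a function on all of `ℕ`, extended by `0`. -/
def extend (a : Fin N → ℝ) (k : ℕ) : ℝ := if h : k < N then a ⟨k, h⟩ else 0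

theorem extend_fin (a : Fin N → ℝ) (k : Fin N) : extend a k = a k := by simp [extend]

theorem extend_of_le (a : Fin N → ℝ) {k : ℕ} (h : N ≤ k) : extend a k = 0 := by
  simp [extend, not_lt.2 h]

theorem sum_range_eq_sum_fin {V : Type*} [AddCommMonoid V] {K : ℕ} (hK : N ≤ K) (F : ℕ → V)
    (hF : ∀ k, N ≤ k → F k = 0) : ∑ k ∈ Finset.range K, F k = ∑ k : Fin N, F k := by
  rw [Fin.sum_univ_eq_sum_range]
  refine (Finset.sum_subset (Finset.range_subset_range.2 hK) fun k _ hk => hF k ?_).symm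
  simpa using hk

theorem blackBox_tail (a : Fin N → ℝ) (hN : 1 ≤ N) {K : ℕ} (hK : N ≤ K) (κ : ℕ) :
    blackBox a κ (N - 1) = ∑ k ∈ Finset.Ico κ K, extend a k := by
  have h1 : ∑ k ∈ Finset.Ico κ K, extend a k =
      ∑ k ∈ Finset.range K, if κ ≤ k then extend a k else 0 := by
    rw [← Finset.sum_filter]
    congr 1
    ext k
    simp [and_comm]
  rw [h1, sum_range_eq_sum_fin hK _ fun k hk => by simp [extend_of_le a hk]]
  unfold blackBox
  split_ifs with h
  · refine Finset.sum_congr rfl fun k _ => ?_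
    have : (k : ℕ) ≤ N - 1 := by omega
    simp [this, extend_fin]
  · refine (Finset.sum_eq_zero fun k _ => if_neg ?_).symm
    omega

theorem encode_injective {n : ℕ} (hN : N ≤ 2 ^ n) :
    Function.Injective (encode n : Fin N → Fin n → Bool) := fun m m' h =>
  Fin.ext (eq_of_testBit_fin_eq (m.2.trans_le hN) (m'.2.trans_le hN) (congrFun h))

theorem encodeMatrix_mul_mul (n : ℕ) (X : Matrix (Fin N) (Fin N) ℂ) :
    encodeMatrix N n * X * (encodeMatrix N n).conjTranspose =
      ∑ m, ∑ m', X m m' • Matrix.single (encode n m) (encode n m') 1 := by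
  ext x y
  simp only [Matrix.mul_apply, Matrix.conjTranspose_apply, encodeMatrix, Matrix.sum_apply,
    Matrix.smul_apply, Matrix.single_apply, smul_eq_mul, Finset.sum_mul]
  rw [Finset.sum_comm]
  refine Finset.sum_congr rfl fun m _ => Finset.sum_congr rfl fun m' _ => ?_
  by_cases h1 : x = encode n m <;> by_cases h2 : y = encode n m' <;>
    simp [h1, h2, eq_comm]

theorem initState_eq_ket (n : ℕ) (t : ℝ) (m : Fin N) :
    initState n (2 * n + 1) (9 * n + 17) t m =
      ket 0 (encode n m) false 0 (fun l => if l = 0 then t else 0) 1 := by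
  unfold initState ket bits regs
  congr 2
  · simp
  · funext i
    simp only [Fin.ext_iff, Fin.val_zero]

theorem channel_mainCircuit {n : ℕ} (hN : 1 ≤ N) (hn : N ≤ 2 ^ n) {a : Fin N → ℝ}
    (ha : ∀ k, 0 ≤ a k) {t : ℝ} (ht : 0 < t) (ρ : Matrix (Fin N) (Fin N) ℂ) :
    Circuit.channel (mainCircuit n (N - 1)) (blackBox a) t ρ =
      encodeMatrix N n * relaxation a t ρ * (encodeMatrix N n).conjTranspose := by
  have hg : ∀ k, 0 ≤ extend a k := fun k => by
    unfold extend
    split_ifs with h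
    · exact ha _
    · exact le_refl 0
  have hS : ∑ k ∈ Finset.range (2 ^ n), extend a k = ∑ k, a k := by
    rw [sum_range_eq_sum_fin hn _ fun k hk => extend_of_le a hk]
    simp only [extend_fin]
  obtain ⟨α, Z₀, Z₁, hα, hw, hZ, happ⟩ := apply_mainCircuit (blackBox a)
    (by omega : N - 1 < 2 ^ n) hg (fun κ _ => blackBox_tail a hN hn κ) hS
    (ζ := fun l => if l = 0 then t else 0) (fun l hl => if_neg hl)
  have hp := resetProb_nonneg ha ht
  have hrel := relaxation_eq a t ρ
  have hle := exp_le_one_of_nonneg ha ht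
  have hpk : ∀ k : Fin N, resetProb a t k =
    (1 - Real.exp (-2 * (∑ i, a i) * t)) * a k / ∑ i, a i := fun _ => rfl
  simp only [if_true] at happ
  set S := ∑ k, a k
  set θ := Real.arccos (Real.exp (-(S * t)))
  have hsq : Real.exp (-(S * t)) ^ 2 = Real.exp (-2 * S * t) := by
    rw [sq, ← Real.exp_add]
    congr 1
    ring
  have hcos : Real.cos θ ^ 2 = Real.exp (-2 * S * t) := by
    rw [Real.cos_arccos (by linarith [Real.exp_pos (-(S * t))]), hsq]
    rw [← hsq] at hle
    nlinarith [Real.exp_pos (-(S * t))]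
  have hsin : Real.sin θ ^ 2 = 1 - Real.exp (-2 * S * t) := by rw [Real.sin_sq, hcos]
  have hprob : ∀ k ∈ Finset.range (2 ^ n), Real.sin θ ^ 2 * α k ^ 2 =
      (1 - Real.exp (-2 * S * t)) * extend a k / S := by
    intro k hk
    rw [hsin, ← hw k hk]
    by_cases hS0 : S = 0
    · simp [hS0]
    · field_simp
  have hred : ∀ m m' : Fin N, reduced
      (Circuit.apply (blackBox a) (mainCircuit n (N - 1))
        (initState n (2 * n + 1) (9 * n + 17) t m))
      (Circuit.apply (blackBox a) (mainCircuit n (N - 1))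
        (initState n (2 * n + 1) (9 * n + 17) t m')) =
      ((Real.exp (-2 * S * t) : ℝ) : ℂ) • Matrix.single (encode n m) (encode n m') 1 +
        if m = m' then ∑ k : Fin N, (resetProb a t k : ℂ) •
          Matrix.single (encode n k) (encode n k) 1 else 0 := by
    intro m m'
    rw [initState_eq_ket, initState_eq_ket, happ, happ, reduced_final _ hα hZ, hcos]
    simp only [(encode_injective hn).eq_iff]
    congr 2
    rw [Finset.sum_congr rfl fun k hk => by rw [hprob k hk], sum_range_eq_sum_fin hn]
    · simp only [extend_fin, hpk]
      rfl
    · intro k hk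
      simp [extend_of_le a hk]
  unfold Circuit.channel
  rw [encodeMatrix_mul_mul, hrel]
  simp only [hred, smul_add, Finset.sum_add_distrib, Matrix.add_apply, Matrix.smul_apply,
    smul_eq_mul, add_smul, smul_ite, smul_zero, Finset.sum_ite_eq, Finset.mem_univ, if_true,
    Matrix.diagonal_apply, mul_ite, mul_zero, ite_smul, zero_smul]
  congr 1
  · simp only [smul_smul, mul_comm]
  · rw [← Finset.sum_smul, Finset.smul_sum]
    simp only [smul_smul]
    rfl

end Simulation

end DenseDiagonal

open DenseDiagonal in
theorem mainTheorem5 :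
    ∃ p : Polynomial ℕ, ∀ N : ℕ, 1 ≤ N →
      ∃ (s r : ℕ) (C : Circuit (Nat.clog 2 N) s r),
        C.length ≤ p.eval (Nat.clog 2 N) ∧
        ∀ a : Fin N → ℝ, (∀ k, 0 ≤ a k) →
          -- the Lindbladian is the one with diagonal GKS matrix `A_{(k,l),(k,l)} = a k`
          diagonalLindbladian (fun k _ => a k) =
            gksGenerator (Matrix.diagonal fun kl : Fin N × Fin N => (a kl.1 : ℂ)) ∧
          ((∀ k, 0 < a k) →
            (Matrix.diagonal fun kl : Fin N × Fin N => (a kl.1 : ℂ)).rank = N ^ 2) ∧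
          -- the fixed state
          diagonalLindbladian (fun k _ => a k) (fixedState a) = 0 ∧
          (0 < ∑ k, a k → (fixedState a).trace = 1) ∧
          ∀ t : ℝ, 0 < t →
            ∃ E : Matrix (Fin N) (Fin N) ℂ → Matrix (Fin N) (Fin N) ℂ,
              IsExp (diagonalLindbladian fun k _ => a k) t E ∧
              -- the circuit simulates the evolution without error
              (∀ ρ, C.channel (blackBox a) t ρ =
                encodeMatrix N (Nat.clog 2 N) * E ρ *
                  (encodeMatrix N (Nat.clog 2 N)).conjTranspose) ∧
              -- the explicit isometry
              (stinespring a t).conjTranspose * stinespring a t = 1 ∧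
              (∀ ρ, E ρ = traceAnc (stinespring a t * ρ * (stinespring a t).conjTranspose)) ∧
              (∀ u, E (Matrix.single u u 1) =
                ((Real.exp (-2 * (∑ k, a k) * t) : ℝ) : ℂ) • Matrix.single u u (1 : ℂ) +
                ((1 - Real.exp (-2 * (∑ k, a k) * t) : ℝ) : ℂ) • fixedState a) ∧
              (∀ u v, u ≠ v → E (Matrix.single u v 1) =
                ((Real.exp (-2 * (∑ k, a k) * t) : ℝ) : ℂ) • Matrix.single u v (1 : ℂ)) := by
  refine ⟨20 * Polynomial.X + 8, fun N hN => ⟨_, _, mainCircuit (Nat.clog 2 N) (N - 1), ?_, ?_⟩⟩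
  · simpa using length_mainCircuit (Nat.clog 2 N) (N - 1)
  · intro a ha
    have : NeZero N := ⟨by omega⟩
    refine ⟨diagonalLindbladian_eq_gksGenerator a, rank_diagonal_of_pos a,
      diagonalLindbladian_fixedState ha, fun hS => ?_, fun t ht => ⟨relaxation a t,
      isExp_relaxation ha t, channel_mainCircuit hN (Nat.le_pow_clog one_lt_two N) ha ht,
      stinespring_isometry ha ht, relaxation_eq_traceAnc ha ht, relaxation_single_self a t,
      fun u v h => relaxation_single_of_ne a t h⟩⟩
    rw [trace_fixedState, div_self hS.ne', Complex.ofReal_one]
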